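/- Let $F_2$ be the free group with basis $\mathcal A=\{a,b\}$ and let $U=(u_1,\dots,u_r)$ be a finite list (repetitions allowed) of cyclically reduced words in $F_2$. For $g\in F_2$ let $\|g\|$ be the length of a cyclically reduced conjugate of $g$. Suppose that * $U$ is \emph{minimal}: no automorphism of $F_2$ reduces the sum of the lengths of the words in $U$, taken as cyclic words; that is, $\sum_i\|u_i\|\le\sum_i\|\varphi(u_i)\|$ for every $\varphi\in\operatorname{Aut}(F_2)$ (note that $\|u_i\|=|u_i|$, since $u_i$ is cyclically reduced); * $U$ is \emph{diskbusting}: one cannot write $F_2=A*B$ with $A,B\neq\{1\}$ and each $u_i$ conjugate into $A$ or into $B$. Then $U$ is \emph{polygonal}: there are polygonal disks $P_1,\dots,P_m$ (closed disks whose boundary circles are subdivided into finitely many, and at least one, sides), a side-pairing $\sim$ on them (a partition of the set of all sides into classes of exactly two sides, with a homeomorphism between the two sides of each class; it need not respect any orientation), and, for the closed surface $S=\coprod_i P_i/\!\sim$ with its induced cell structure, an immersion (locally injective graph map) from the $1$-skeleton $S^{(1)}$ to the bouquet of two oriented circles labelled $a$ and $b$, such that 1. for each $i$, the closed path $\partial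 P_i\to S^{(1)}\to$ bouquet reads (from a suitable starting point and in a suitable direction) a nontrivial power $u^c$, $c\ne0$, of some word $u$ in $U$; 2. $\chi(S)<m$. -/

import Mathlib

namespace TilingRankTwo

open FreeGroup

/-! ### Words, minimality, diskbusting lists -/

/-- The inverse of a letter; `(x, true)` is the generator `x` and `(x, false)` is its inverse. -/
def letterInv {α : Type*} (x : α × Bool) : α × Bool := (x.1, !x.2)

/-- The length of the conjugacy class of `g`: the length of a cyclically reduced conjugate of `g`.
For `g` whose reduced word is cyclically reduced, this is the length of that word. -/
def cyclicLength {α : Type*} [DecidableEq α] (g : FreeGroup α) : ℕ :=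
  (reduceCyclically g.toWord).length

/-- No automorphism of the free group reduces the sum of the lengths of the words in the list,
words being considered up to conjugation (that is, as cyclic words). -/
def IsMinimal {α : Type*} [DecidableEq α] (U : List (FreeGroup α)) : Prop :=
  ∀ φ : FreeGroup α ≃* FreeGroup α,
    (U.map cyclicLength).sum ≤ (U.map fun u => cyclicLength (φ u)).sum

/-- `G` is the (internal) free product of its subgroups `A` and `B`. -/
def IsFreeProduct {G : Type*} [Group G] (A B : Subgroup G) : Prop :=
  Function.Bijective (Monoid.Coprod.lift A.subtype B.subtype)

/-- `u` is conjugate into the subgroup `A`. -/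
def IsConjInto {G : Type*} [Group G] (u : G) (A : Subgroup G) : Prop :=
  ∃ g : G, g * u * g⁻¹ ∈ A

/-- One cannot write `G = A * B` with `A, B ≠ 1` and each element of the list conjugate into
`A` or `B`. -/
def IsDiskbusting {G : Type*} [Group G] (U : List G) : Prop :=
  ¬ ∃ A B : Subgroup G, A ≠ ⊥ ∧ B ≠ ⊥ ∧ IsFreeProduct A B ∧
    ∀ u ∈ U, IsConjInto u A ∨ IsConjInto u B

/-! ### Surfaces obtained by pairing the sides of polygonal disks -/

/-- Polygonal disks `P_0, …, P_{m-1}`, the disk `P_i` having `sides i ≥ 1` sides, with a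
side-pairing. Sides are indexed cyclically along each boundary circle, which is thereby directed.
Every class of paired sides consists of two distinct sides `s` and `pair s`; the choice of a
homeomorphism `s → pair s` amounts, up to isotopy, to saying whether it reverses (`true`) or
preserves (`false`) the boundary directions. -/
structure SidePairing where
  m : ℕ
  sides : Fin m → ℕ
  sides_pos : ∀ i, 0 < sides i
  pair : (Σ i, Fin (sides i)) → (Σ i, Fin (sides i))
  pair_pair : ∀ s, pair (pair s) = s
  pair_ne : ∀ s, pair s ≠ s
  reverses : (Σ i, Fin (sides i)) → Bool
  reverses_pair : ∀ s, reverses (pair s) = reverses s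

namespace SidePairing

variable (P : SidePairing)

/-- The sides of the disks. -/
abbrev Side : Type := Σ i, Fin (P.sides i)

/-- The corners (vertices of the boundary circles) of the disks; `⟨i, k⟩` is the corner at which
the side `⟨i, k⟩` begins. -/
abbrev Corner : Type := Σ i, Fin (P.sides i)

/-- Oriented sides: `(s, true)` is `s` with the boundary direction, `(s, false)` is `s` with the
opposite direction. -/
abbrev Dart : Type := P.Side × Bool

/-- The corner at which an oriented side begins; the side `⟨i, k⟩` runs from the corner `⟨i, k⟩`
to the cyclically next corner of the same disk. -/
def origin : P.Dart → P.Corner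
  | (s, true) => s
  | (s, false) => ⟨s.1, finRotate (P.sides s.1) s.2⟩

/-- The opposite orientation of an oriented side. -/
def flip (d : P.Dart) : P.Dart := (d.1, !d.2)

/-- The oriented side with which an oriented side is identified. -/
def glue (d : P.Dart) : P.Dart := (P.pair d.1, xor d.2 (P.reverses d.1))

/-- The vertices of `S`: corners, under the equivalence relation generated by identifying the
origins of identified oriented sides. (The terminal points are covered by `flip`.) -/
def Vertex : Type :=
  Quot fun p q : P.Corner => ∃ d : P.Dart, P.origin d = p ∧ P.origin (P.glue d) = q

/-- The oriented edges of `S`. -/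
def OrientedEdge : Type := Quot fun d e : P.Dart => e = P.glue d

/-- The (unoriented) edges of `S`. -/
def Edge : Type := Quot fun s t : P.Side => t = P.pair s

/-- The Euler characteristic of the closed surface `S`, computed from its cell structure. -/
noncomputable def eulerChar : ℤ := (Nat.card P.Vertex : ℤ) - Nat.card P.Edge + P.m

/-- The oriented edge of `S` given by an oriented side. -/
def toEdge (d : P.Dart) : P.OrientedEdge := Quot.mk _ d

/-- The initial vertex of an oriented edge of `S`. -/
def source : P.OrientedEdge → P.Vertex :=
  Quot.lift (fun d => Quot.mk _ (P.origin d)) (by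
    rintro d e rfl
    exact Quot.sound ⟨d, rfl, rfl⟩)

lemma glue_flip (d : P.Dart) : P.glue (P.flip d) = P.flip (P.glue d) := by
  rcases d with ⟨s, b⟩
  cases b <;> cases h : P.reverses s <;> simp [glue, flip, h]

/-- The reversal of orientation on the oriented edges of `S`. -/
def rev : P.OrientedEdge → P.OrientedEdge :=
  Quot.lift (fun d => P.toEdge (P.flip d)) (by
    rintro d e rfl
    exact Quot.sound (P.glue_flip d).symm)

/-- An immersion (locally injective graph map) from the `1`-skeleton of `S` to the bouquet of
oriented circles indexed by `α`: each oriented edge is mapped to a circle with one of its two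
orientations, i.e. to a letter, compatibly with reversal, and distinct oriented edges with the
same initial vertex are mapped to distinct letters. -/
structure Immersion (α : Type*) where
  label : P.OrientedEdge → α × Bool
  label_rev : ∀ e, label (P.rev e) = letterInv (label e)
  locally_injective : ∀ e e', P.source e = P.source e' → label e = label e' → e = e'

variable {P} in
/-- The word read by the composition `∂P_i → S^{(1)} → bouquet`, from the corner `⟨i, 0⟩` on. -/
def Immersion.boundaryWord {α : Type*} (f : P.Immersion α) (i : Fin P.m) : List (α × Bool) :=
  List.ofFn fun k : Fin (P.sides i) => f.label (P.toEdge (⟨i, k⟩, true))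

end SidePairing

/-- A list of (cyclically reduced) words is polygonal: some side-pairing on polygonal disks
`P_0, …, P_{m-1}`, with quotient `S`, and some immersion of the `1`-skeleton of `S` to the bouquet
are such that each `∂P_i` reads (from a suitable corner on) a nontrivial power of a word in the
list, and `χ(S) < m`. -/
def IsPolygonal {α : Type*} [DecidableEq α] (U : List (FreeGroup α)) : Prop :=
  ∃ (P : SidePairing) (f : P.Immersion α),
    (∀ i, ∃ u ∈ U, ∃ c : ℤ, c ≠ 0 ∧ f.boundaryWord i ~r (u ^ c).toWord) ∧
    P.eulerChar < P.m

end TilingRankTwo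

/-!
A corner of a cyclic word, lying between two consecutive letters, is an edge of the Whitehead graph
of `U`, whose vertices are the letters. Its two ends are called flags. In a surface of the required
kind every vertex has as its link a cycle of corners, and since the `1`-skeleton is immersed in the
bouquet, this is a simple cycle of the Whitehead graph. Conversely, take a finite family of simple
cycles of the Whitehead graph. At a letter `l`, such a cycle makes two flags labelled `l` adjacent,
which means that the side starting with these flags is to be shared by two disks. If every pair of
flags is adjacent as often as the pair of flags at the other ends of the two sides is, then the
cycles are the links of the vertices of a surface tiled by disks whose boundaries read powers of the
given words (`exists_immersion_of_isBalanced`, `wordSystem_ofFn_isRotated`). Each vertex has degree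
at least two, so `χ(S) ≤ m`, and the inequality is strict as soon as one cycle has length at least
three. Thus the problem is to find a balanced family of simple cycles, not all of length two.

For a rank two group with letters `a^{±1}` and `b^{±1}`, the Whitehead graph has `p` edges from `a`
to `a⁻¹`, `q` edges from `b` to `b⁻¹`, `x` edges from `a` to `b` and as many from `a⁻¹` to `b⁻¹`,
and `y` edges from `a` to `b⁻¹` and as many from `a⁻¹` to `b`. Comparison of the lengths under a
Whitehead automorphism gives `|x - y| ≤ q` and `|x - y| ≤ p` (`card_le_card_cut_of_isMinimal`), and
since `U` is diskbusting, `x + y > 0` (`exists_fst_ne_of_isDiskbusting`). One may assume `q ≤ p`.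
Take all cycles of length two and all cycles of length four, with a suitable multiplicity for each
type. All pairs of flags labelled `b`, or labelled `b⁻¹`, are then adjacent equally often. For the
letters `a^{±1}` the same holds up to a deficit proportional to `p - q`, which affects exactly the
pairs of a corner from `a^{±1}` to `a^{∓1}` and a corner from `a^{±1}` to `b^{±1}`
(`exists_balanced_links`).

The deficit is made up by brick patterns, built from rows of letters `b`. A row consists of the
maximal blocks `b^k` in the given words, where a block may follow another one when the corners
between them are joined by an edge from `a^{±1}` to its inverse. Two rows are laid side by side,
and each place at which two consecutive letters of one row meet two consecutive letters of the
other is filled with cycles of length two, three or four, unless blocks of the same kind start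
there in both rows (`exists_realizesStep`). If the aligned pairs of letters recur, the cycles are
balanced along the rows, and what they contribute at the letters `a^{±1}` is exactly of the kind
that is missing (`exists_links_of_steps`). A coincidence of block beginnings of the same kind can
only be forced by blocks of one letter with the same label at both ends. Such a letter is repeated
in one row against a row of other letters (`exists_links_of_single`), while rows without such
letters are laid against their own translates (`exists_links_of_translate`). Because
`|x - y| ≤ q`, there are enough other letters to use every letter `b` equally often
(`exists_links_of_bricks`), which makes up the deficit uniformly.
-/


namespace TilingRankTwo

open FreeGroup

/-! ### Systems of flags and links -/

@[simp] lemma letterInv_letterInv {β : Type*} (l : β × Bool) : letterInv (letterInv l) = l := by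
  simp [letterInv]

lemma letterInv_ne {β : Type*} (l : β × Bool) : letterInv l ≠ l := by
  intro h
  simpa [letterInv] using congrArg Prod.snd h

/-- A flag is one of the two ends of a corner of a cyclic word: a corner lies between two
consecutive letters, and its ends are the directions of the two sides meeting there, labelled by
the letters read when leaving the corner. The involution `across` exchanges the ends of a corner,
and `along` exchanges the flags at the two ends of a side. Equivalently, corners are the edges of
the Whitehead graph, whose vertices are the letters, and `along` is its connecting map. -/
structure FlagSystem (W β : Type) where
  across : W → W
  along : W → W
  lab : W → β × Bool
  across_across : ∀ t, across (across t) = t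
  along_along : ∀ t, along (along t) = t
  lab_along : ∀ t, lab (along t) = letterInv (lab t)
  lab_across_ne : ∀ t, lab (across t) ≠ lab t

namespace FlagSystem

variable {W β : Type} (S : FlagSystem W β)

/-- The flag reached from `t` by walking along its side and turning at the corner found there. -/
def next (t : W) : W := S.across (S.along t)

/-- A simple cycle of length at least two in the Whitehead graph, the possible link of a vertex of
a surface: `flag k` and `across (flag k)` are the ends of the `k`-th edge of the cycle. -/
structure Link where
  n : ℕ
  two_le : 2 ≤ n
  flag : Fin n → W
  lab_injective : Function.Injective fun k => S.lab (flag k)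
  lab_across : ∀ k, S.lab (S.across (flag k)) = S.lab (flag (finRotate n k))

variable {S}

/-- The sum of `Φ` over the pairs of flags which are adjacent at a vertex of the cycle. -/
def Link.pairSum (C : S.Link) (Φ : W → W → ℤ) : ℤ :=
  ∑ k, Φ (S.across (C.flag k)) (C.flag (finRotate C.n k))

lemma finRotate_rev_finRotate {n : ℕ} (k : Fin n) :
    finRotate n (Fin.rev (finRotate n k)) = Fin.rev k := by
  have := k.neZero
  rw [finRotate_apply, finRotate_apply]
  rcases n with _ | n
  · exact k.elim0
  · rw [Fin.rev_add]
    abel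

/-- The same cycle run through in the opposite direction. -/
def Link.reverse (C : S.Link) : S.Link where
  n := C.n
  two_le := C.two_le
  flag k := S.across (C.flag (Fin.rev k))
  lab_injective i j h := by
    simp only [C.lab_across] at h
    exact Fin.rev_injective ((finRotate _).injective (C.lab_injective h))
  lab_across k := by
    rw [S.across_across, C.lab_across, finRotate_rev_finRotate]

lemma Link.pairSum_reverse (C : S.Link) (Φ : W → W → ℤ) :
    C.reverse.pairSum Φ = C.pairSum fun t t' => Φ t' t := by
  unfold Link.pairSum
  refine Fintype.sum_equiv ((finRotate C.n).trans Fin.revPerm) _ _ fun k => ?_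
  simp only [Link.reverse, Equiv.trans_apply, Fin.revPerm_apply, S.across_across,
    finRotate_rev_finRotate]
  rfl

end FlagSystem

/-! ### Surfaces from balanced families of links -/

/-- An involution covering a given involution `j` of the keys exists when the fibres over `k` and
`j k` are equinumerous, provided that `j` has no fixed keys, as witnessed by a sign. -/
lemma exists_involution_of_card_fiber {D K : Type*} [Fintype D] [DecidableEq K]
    (key : D → K) (j : K → K) (hj : ∀ k, j (j k) = k) (sgn : K → Bool)
    (hs : ∀ d, sgn (j (key d)) = !sgn (key d))
    (hc : ∀ k, Fintype.card {d // key d = k} = Fintype.card {d // key d = j k}) :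
    ∃ τ : D → D, (∀ d, τ (τ d) = d) ∧ ∀ d, key (τ d) = j (key d) := by
  classical
  have e : ∀ k, {d // key d = k} ≃ {d // key d = j k} := fun k => Fintype.equivOfCardEq (hc k)
  let τ : D → D := fun d =>
    if sgn (key d) then (e (key d) ⟨d, rfl⟩).1 else ((e (j (key d))).symm ⟨d, (hj _).symm⟩).1
  have hkey : ∀ d, key (τ d) = j (key d) := by
    intro d
    by_cases h : sgn (key d) = true
    · simp only [τ, h, if_true]
      exact (e (key d) ⟨d, rfl⟩).2
    · simp only [τ, h]
      exact ((e (j (key d))).symm ⟨d, (hj _).symm⟩).2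
  have h1 : ∀ d k (hd : key d = k), sgn k = true → τ d = (e k ⟨d, hd⟩).1 := by
    rintro d _ rfl h
    simp [τ, h]
  have h2 : ∀ d k (hd : key d = j k), sgn k = true → τ d = ((e k).symm ⟨d, hd⟩).1 := by
    intro d k hd h
    obtain rfl : k = j (key d) := by rw [hd, hj]
    have h' : sgn (key d) = false := by
      have := hs d
      rw [h] at this
      simpa using this.symm
    simp [τ, h']
  refine ⟨τ, fun d => ?_, hkey⟩
  by_cases h : sgn (key d) = true
  · rw [h2 (τ d) (key d) (hkey d) h]
    have : (⟨τ d, hkey d⟩ : {x // key x = j (key d)}) = e (key d) ⟨d, rfl⟩ :=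
      Subtype.ext (h1 d _ rfl h)
    rw [this, Equiv.symm_apply_apply]
  · have h' : sgn (j (key d)) = true := by rw [hs]; simpa using h
    rw [h1 (τ d) (j (key d)) (hkey d) h']
    have : (⟨τ d, hkey d⟩ : {x // key x = j (key d)}) =
        (e (j (key d))).symm ⟨d, (hj _).symm⟩ := Subtype.ext (h2 d _ _ h')
    rw [this, Equiv.apply_symm_apply]

lemma val_finRotate {n : ℕ} (k : Fin n) : (finRotate n k : ℕ) = (k + 1) % n := by
  have := k.neZero
  rw [finRotate_apply, Fin.val_add, Fin.val_one', Nat.add_mod_mod]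

/-- Coordinates on a finite set in which a given permutation is the cyclic rotation of finitely
many cyclic sequences. -/
lemma exists_orbit_coordinates {D : Type*} [Finite D] (φ : Equiv.Perm D) :
    ∃ (m : ℕ) (sides : Fin m → ℕ) (_ : ∀ i, 0 < sides i) (e : (Σ i, Fin (sides i)) ≃ D),
      ∀ i k, e ⟨i, finRotate _ k⟩ = φ (e ⟨i, k⟩) := by
  classical
  let Q := Quotient (Equiv.Perm.SameCycle.setoid φ)
  obtain ⟨m, ⟨q⟩⟩ := Finite.exists_equiv_fin Q
  let r : Fin m → D := fun i => (q.symm i).out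
  have hr : ∀ i, (Quotient.mk _ (r i) : Q) = q.symm i := fun i => Quotient.out_eq _
  have hpos : ∀ d : D, 0 < Function.minimalPeriod φ d := fun d =>
    Function.minimalPeriod_pos_of_mem_periodicPts (φ.injective.mem_periodicPts d)
  have hit : ∀ (k : ℕ) (d : D), (φ : D → D)^[k] d = (φ ^ k) d := fun k d => by
    rw [Equiv.Perm.iterate_eq_pow]
  let f : (Σ i, Fin (Function.minimalPeriod φ (r i))) → D := fun s => (φ : D → D)^[s.2] (r s.1)
  have hf : Function.Bijective f := by
    constructor
    · rintro ⟨i, k⟩ ⟨i', k'⟩ h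
      have hi : i = i' := by
        apply q.symm.injective
        rw [← hr i, ← hr i']
        apply Quotient.sound
        change φ.SameCycle (r i) (r i')
        have h' : (φ ^ (k : ℕ)) (r i) = (φ ^ (k' : ℕ)) (r i') := by
          rw [← hit, ← hit]; exact h
        have h1 : φ.SameCycle (r i) ((φ ^ (k : ℕ)) (r i)) := ⟨k, by simp⟩
        have h2 : φ.SameCycle (r i') ((φ ^ (k' : ℕ)) (r i')) := ⟨k', by simp⟩
        rw [h'] at h1
        exact h1.trans h2.symm
      subst hi
      have := Function.iterate_injOn_Iio_minimalPeriod (f := φ) (x := r i)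
        (Set.mem_Iio.2 k.2) (Set.mem_Iio.2 k'.2) h
      rw [Fin.ext this]
    · intro d
      have hsc : φ.SameCycle (r (q (Quotient.mk _ d))) d :=
        Quotient.exact (s := Equiv.Perm.SameCycle.setoid φ) (by rw [hr, q.symm_apply_apply])
      obtain ⟨n, -, hn⟩ := hsc.exists_pow_eq'
      refine ⟨⟨q (Quotient.mk _ d), ⟨n % _, Nat.mod_lt n (hpos _)⟩⟩, ?_⟩
      simp only [f]
      rw [Function.iterate_mod_minimalPeriod_eq, hit, hn]
  refine ⟨m, fun i => Function.minimalPeriod φ (r i), fun i => hpos _, Equiv.ofBijective f hf,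
    fun i k => ?_⟩
  simp only [Equiv.ofBijective_apply, f, val_finRotate]
  rw [Function.iterate_mod_minimalPeriod_eq, Function.iterate_succ_apply']

end TilingRankTwo

namespace TilingRankTwo

open FreeGroup
namespace FlagSystem

variable {W β : Type} {S : FlagSystem W β}

/-- The darts leaving the vertices whose links are the members of a family. -/
abbrev LinkDart {ι : Type} (C : ι → S.Link) : Type := Σ i, Fin (C i).n

/-- The two flags at a dart, that is, the flags labelled by the dart of the two corners which it
separates. -/
def dartKey {ι : Type} (C : ι → S.Link) (d : LinkDart C) : W × W :=
  (S.across ((C d.1).flag ((finRotate _).symm d.2)), (C d.1).flag d.2)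

/-- A finite family of links is balanced if the numbers of darts with flags `(t, t')` and with
flags `(along t', along t)` agree; this is what is needed for gluing the darts in pairs to form
the edges of a surface. -/
def IsBalanced {ι : Type} [Fintype ι] (C : ι → S.Link) : Prop :=
  ∀ Φ : W → W → ℤ, ∑ i, (C i).pairSum Φ =
    ∑ i, (C i).pairSum fun t t' => Φ (S.along t') (S.along t)

lemma sum_pairSum_eq_card {ι : Type} [Fintype ι] [DecidableEq W] (C : ι → S.Link) (κ : W × W) :
    ∑ i, (C i).pairSum (fun t t' => if (t, t') = κ then 1 else 0) =
      Fintype.card {d : LinkDart C // dartKey C d = κ} := by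
  rw [Fintype.card_subtype, Finset.card_filter, Nat.cast_sum, Fintype.sum_sigma]
  refine Finset.sum_congr rfl fun i _ => ?_
  unfold Link.pairSum
  refine Fintype.sum_equiv (finRotate _) _ _ fun k => ?_
  simp only [dartKey, Equiv.symm_apply_apply, Nat.cast_ite, Nat.cast_one, Nat.cast_zero]

/-- The faces of the surface are the orbits of the permutation "walk along the dart, then turn";
so they read words by iterating `next`. The vertices are the given links, and the Euler
characteristic is found by counting darts. -/
theorem exists_immersion_of_isBalanced {ι : Type} [Fintype ι] (C : ι → S.Link)
    (hC : IsBalanced C) (h3 : ∃ i, 3 ≤ (C i).n) :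
    ∃ (P : SidePairing) (f : P.Immersion β),
      (∀ i, ∃ t : W, S.next^[P.sides i] t = t ∧
        f.boundaryWord i = List.ofFn fun k : Fin (P.sides i) => S.lab (S.next^[k] t)) ∧
      P.eulerChar < P.m := by
  classical
  let L : LinkDart C → W := fun d => (C d.1).flag d.2
  let R : LinkDart C → W := fun d => S.across ((C d.1).flag ((finRotate _).symm d.2))
  have hRL : ∀ d, S.lab (R d) = S.lab (L d) := fun d => by
    simp only [R, L, (C d.1).lab_across, Equiv.apply_symm_apply]
  let ρ : Equiv.Perm (LinkDart C) := Equiv.sigmaCongrRight fun i => finRotate _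
  have hρ1 : ∀ d, (ρ d).1 = d.1 := fun d => rfl
  have hRρ : ∀ d, R (ρ d) = S.across (L d) := fun d => by
    change S.across ((C d.1).flag ((finRotate _).symm (finRotate _ d.2))) = _
    rw [Equiv.symm_apply_apply]
  obtain ⟨τ, hττ, hτ⟩ := exists_involution_of_card_fiber (dartKey C)
    (fun κ => (S.along κ.2, S.along κ.1)) (fun κ => by simp [S.along_along])
    (fun κ => (S.lab κ.2).2)
    (fun d => by
      have := hRL d
      change S.lab (dartKey C d).1 = S.lab (dartKey C d).2 at this
      simp [S.lab_along, this, letterInv])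
    (fun κ => by
      have h := hC (fun t t' => if (t, t') = κ then 1 else 0)
      have h' : (fun t t' => if (S.along t', S.along t) = κ then (1 : ℤ) else 0) =
          fun t t' => if (t, t') = (S.along κ.2, S.along κ.1) then 1 else 0 := by
        funext t t'
        congr 1
        rw [Prod.ext_iff, Prod.ext_iff]
        apply propext
        constructor
        · rintro ⟨h1, h2⟩
          simp only at h1 h2
          simp [← h1, ← h2, S.along_along]
        · rintro ⟨h1, h2⟩
          simp only at h1 h2
          simp [h1, h2, S.along_along]
      rw [h', sum_pairSum_eq_card, sum_pairSum_eq_card] at h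
      exact_mod_cast h)
  have hRτ : ∀ d, R (τ d) = S.along (L d) := fun d => congrArg Prod.fst (hτ d)
  have hLτ : ∀ d, L (τ d) = S.along (R d) := fun d => congrArg Prod.snd (hτ d)
  have hlτ : ∀ d, S.lab (L (τ d)) = letterInv (S.lab (L d)) := fun d => by
    rw [hLτ, S.lab_along, hRL]
  have hτne : ∀ d, τ d ≠ d := fun d h => by
    have := hlτ d
    rw [h] at this
    exact letterInv_ne _ this.symm
  let τp : Equiv.Perm (LinkDart C) := ⟨τ, τ, hττ, hττ⟩
  let φ : Equiv.Perm (LinkDart C) := τp.trans ρ.symm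
  have hφ : ∀ d, ρ (φ d) = τ d := fun d => by simp [φ, τp]
  have hLφ : ∀ d, L (φ d) = S.next (L d) := fun d => by
    have h1 := hRρ (φ d)
    rw [hφ, hRτ] at h1
    rw [next, h1, S.across_across]
  obtain ⟨m, sides, sides_pos, e, he⟩ := exists_orbit_coordinates φ
  let P : SidePairing :=
    { m := m
      sides := sides
      sides_pos := sides_pos
      pair := fun s => e.symm (τ (e s))
      pair_pair := fun s => by simp [hττ]
      pair_ne := fun s h => hτne (e s) (by
        have := congrArg e h
        simpa using this)
      reverses := fun _ => true
      reverses_pair := fun _ => rfl }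
  -- The label of an oriented side, and the link of the vertex at which it begins.
  let labD : P.Dart → β × Bool := fun d =>
    if d.2 then S.lab (L (e d.1)) else letterInv (S.lab (L (e d.1)))
  have hglue : ∀ d : P.Dart, P.glue d = (e.symm (τ (e d.1)), !d.2) := fun d => by
    simp [SidePairing.glue, P]
  have hlabglue : ∀ d : P.Dart, labD (P.glue d) = labD d := by
    rintro ⟨s, b⟩
    rw [hglue]
    cases b <;> simp [labD, hlτ]
  have horig : ∀ s : P.Side, e (P.origin (s, false)) = φ (e s) := by
    rintro ⟨i, k⟩
    exact he i k
  have hrel : ∀ d : P.Dart, (e (P.origin (P.glue d)) = ρ.symm (e (P.origin d))) ∨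
      (e (P.origin d) = ρ.symm (e (P.origin (P.glue d)))) := by
    rintro ⟨s, b⟩
    rw [hglue]
    cases b
    · right
      simp only [Bool.not_false]
      rw [horig]
      change φ (e s) = ρ.symm (e (e.symm (τ (e s))))
      simp [φ, τp]
    · left
      simp only [Bool.not_true]
      rw [horig]
      change φ (e (e.symm (τ (e s)))) = ρ.symm (e s)
      simp [φ, τp, hττ]
  have hρs : ∀ d, (ρ.symm d).1 = d.1 := fun d => by
    conv_rhs => rw [← ρ.apply_symm_apply d]
    rfl
  let vlink : P.Vertex → ι := Quot.lift (fun c => (e c).1) (by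
    rintro p q ⟨d, rfl, rfl⟩
    rcases hrel d with h | h
    · rw [h, hρs]
    · rw [h, hρs])
  have hrep : ∀ x : P.OrientedEdge, ∃ s : P.Side, x = P.toEdge (s, true) := by
    intro x
    obtain ⟨⟨s, b⟩, rfl⟩ := Quot.exists_rep x
    cases b
    · refine ⟨e.symm (τ (e s)), ?_⟩
      apply Quot.sound
      rw [hglue]
      rfl
    · exact ⟨s, rfl⟩
  let f : P.Immersion β :=
    { label := Quot.lift labD (by
        rintro d _ rfl
        exact (hlabglue d).symm)
      label_rev := by
        intro x
        obtain ⟨⟨s, b⟩, rfl⟩ := Quot.exists_rep x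
        change labD (P.flip (s, b)) = letterInv (labD (s, b))
        cases b <;> simp [labD, SidePairing.flip]
      locally_injective := by
        intro x x' hs hl
        obtain ⟨s, rfl⟩ := hrep x
        obtain ⟨s', rfl⟩ := hrep x'
        have h1 : (e s).1 = (e s').1 := congrArg vlink hs
        have h2 : S.lab (L (e s)) = S.lab (L (e s')) := by
          have h2 : labD (s, true) = labD (s', true) := hl
          simpa [labD] using h2
        have h3 : e s = e s' := by
          revert h1 h2
          generalize e s = d
          generalize e s' = d'
          obtain ⟨i, k⟩ := d
          obtain ⟨i', k'⟩ := d'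
          intro h1 h2
          simp only at h1
          subst h1
          exact congrArg _ ((C i).lab_injective h2)
        rw [e.injective h3] }
  have hiter : ∀ i (k : ℕ) (hk : k < sides i), e ⟨i, ⟨k, hk⟩⟩ =
      (φ : LinkDart C → LinkDart C)^[k] (e ⟨i, ⟨0, sides_pos i⟩⟩) := by
    intro i k
    induction k with
    | zero => intro _; rfl
    | succ k ih =>
      intro hk
      rw [Function.iterate_succ_apply', ← ih (by omega), ← he]
      congr 2
      ext
      rw [val_finRotate, Nat.mod_eq_of_lt hk]
  have hper : ∀ i, (φ : LinkDart C → LinkDart C)^[sides i] (e ⟨i, ⟨0, sides_pos i⟩⟩) =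
      e ⟨i, ⟨0, sides_pos i⟩⟩ := by
    intro i
    have hp := sides_pos i
    have hn : sides i = (sides i - 1).succ := by omega
    have h1 := hiter i (sides i - 1) (by omega)
    have h2 := he i ⟨sides i - 1, by omega⟩
    rw [h1, ← Function.iterate_succ_apply' (φ : LinkDart C → LinkDart C), ← hn] at h2
    rw [← h2]
    congr 2
    ext
    rw [val_finRotate]
    simp only [Nat.sub_add_cancel hp, Nat.mod_self]
  have hsemi : Function.Semiconj L φ S.next := hLφ
  refine ⟨P, f, fun i => ⟨L (e ⟨i, ⟨0, sides_pos i⟩⟩), ?_, ?_⟩, ?_⟩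
  · rw [← (hsemi.iterate_right _).eq]
    exact congrArg L (hper i)
  · unfold SidePairing.Immersion.boundaryWord
    congr 1
    funext k
    change labD (⟨i, k⟩, true) = _
    simp only [labD, if_true]
    rw [← (hsemi.iterate_right _).eq, ← hiter i k k.2]
  · have hV : Nat.card P.Vertex ≤ Fintype.card ι := by
      rw [← Nat.card_eq_fintype_card]
      have hz : ∀ i, 0 < (C i).n := fun i => lt_of_lt_of_le (by norm_num) (C i).two_le
      let g : ι → P.Vertex := fun i => Quot.mk _ (e.symm ⟨i, ⟨0, hz i⟩⟩)
      have hstep : ∀ d, (Quot.mk _ (e.symm (ρ d)) : P.Vertex) = Quot.mk _ (e.symm d) := by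
        intro d
        refine Quot.sound ⟨(e.symm (ρ d), true), rfl, ?_⟩
        apply e.injective
        rw [hglue]
        simp only [Bool.not_true]
        rw [horig]
        simp [φ, τp, hττ]
      have hall : ∀ i (k : ℕ) (hk : k < (C i).n),
          (Quot.mk _ (e.symm ⟨i, ⟨k, hk⟩⟩) : P.Vertex) = g i := by
        intro i k
        induction k with
        | zero => intro _; rfl
        | succ k ih =>
          intro hk
          rw [← ih (by omega), ← hstep ⟨i, ⟨k, _⟩⟩]
          congr 2
          change _ = (⟨i, finRotate _ ⟨k, _⟩⟩ : LinkDart C)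
          congr 1
          ext
          rw [val_finRotate]
          exact (Nat.mod_eq_of_lt hk).symm
      refine Nat.card_le_card_of_surjective g fun v => ?_
      obtain ⟨c, rfl⟩ := Quot.exists_rep v
      refine ⟨(e c).1, ?_⟩
      rw [← hall (e c).1 (e c).2 (e c).2.2]
      exact congrArg _ (e.symm_apply_apply c)
    have hE : Fintype.card (LinkDart C) ≤ 2 * Nat.card P.Edge := by
      let sg : LinkDart C → Bool := fun d => (S.lab (L d)).2
      have hsg : ∀ d, sg (τ d) = !sg d := fun d => by simp [sg, hlτ, letterInv]
      -- the representative of an edge whose label is a generator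
      let r : P.Edge → LinkDart C := Quot.lift (fun s => if sg (e s) then e s else τ (e s)) (by
        rintro s _ rfl
        cases h : sg (e s) <;> simp [P, hsg, h, hττ])
      have : Finite P.Edge := Finite.of_surjective _ Quot.mk_surjective
      have hinj : Function.Injective
          fun d : LinkDart C => ((Quot.mk _ (e.symm d) : P.Edge), sg d) := by
        intro d d' h
        simp only [Prod.mk.injEq] at h
        have h1 := congrArg r h.1
        simp only [r, Equiv.apply_symm_apply] at h1
        rw [h.2] at h1
        split_ifs at h1 with h2
        · exact h1
        · rw [← hττ d, h1, hττ]
      have := Nat.card_le_card_of_injective _ hinj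
      rw [Nat.card_prod, Nat.card_eq_fintype_card] at this
      simp only [Nat.card_eq_fintype_card (α := Bool), Fintype.card_bool] at this
      rw [mul_comm]
      exact this
    have hD : 2 * Fintype.card ι < Fintype.card (LinkDart C) := by
      rw [Fintype.card_sigma]
      simp only [Fintype.card_fin]
      calc 2 * Fintype.card ι = ∑ _i : ι, 2 := by simp [mul_comm]
        _ < ∑ i, (C i).n := by
          obtain ⟨i, hi⟩ := h3
          exact Finset.sum_lt_sum (fun i _ => (C i).two_le) ⟨i, Finset.mem_univ _, hi⟩
    unfold SidePairing.eulerChar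
    omega

end FlagSystem
/-! ### The flags of a list of cyclically reduced words -/

lemma getElem_flatten_replicate {γ : Type*} (w : List γ) (m k : ℕ)
    (hk : k < (List.replicate m w).flatten.length) (hk' : k % w.length < w.length) :
    (List.replicate m w).flatten[k] = w[k % w.length] := by
  induction m generalizing k with
  | zero => simp at hk
  | succ m ih =>
    simp only [List.replicate_succ, List.flatten_cons, List.getElem_append]
    split_ifs with h
    · simp [Nat.mod_eq_of_lt h]
    · simp only [List.replicate_succ, List.flatten_cons, List.length_append] at hk
      have hm : (k - w.length) % w.length = k % w.length := by
        conv_rhs => rw [← Nat.sub_add_cancel (not_lt.1 h)]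
        simp
      rw [ih (k - w.length) (by omega) (by omega)]
      simp only [hm]

lemma ofFn_isRotated_flatten_replicate {γ : Type*} (w : List γ) (hw : 0 < w.length) (i m : ℕ)
    {c : ℕ} (hc : c = w.length * m) :
    (List.ofFn fun k : Fin c => w[(i + k) % w.length]'(Nat.mod_lt _ hw)) ~r
      (List.replicate m w).flatten := by
  refine List.IsRotated.symm ⟨i, ?_⟩
  have hlen : (List.replicate m w).flatten.length = c := by
    simp [hc, mul_comm]
  apply List.ext_getElem
  · simp only [List.length_rotate, List.length_ofFn, hlen]
  · intro k h1 h2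
    rw [List.getElem_rotate, getElem_flatten_replicate _ _ _ _ (Nat.mod_lt _ hw),
      List.getElem_ofFn]
    have : (k + i) % (List.replicate m w).flatten.length % w.length = (i + k) % w.length := by
      rw [hlen, hc, Nat.mod_mul_right_mod, add_comm]
    simp only [this]

lemma toWord_pow_of_isCyclicallyReduced {α : Type*} [DecidableEq α] {u : FreeGroup α}
    (hu : IsCyclicallyReduced u.toWord) (m : ℕ) :
    (u ^ m).toWord = (List.replicate m u.toWord).flatten := by
  rw [FreeGroup.toWord_pow]
  exact (hu.flatten_replicate m).isReduced.reduce_eq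

lemma get_finRotate_ne_letterInv {α : Type*} {w : List (α × Bool)}
    (hw : IsCyclicallyReduced w) (k : Fin w.length) :
    w.get (finRotate _ k) ≠ letterInv (w.get k) := by
  have hk := k.2
  intro h
  have key : (w.get k).1 = (w.get (finRotate _ k)).1 →
      (w.get k).2 = (w.get (finRotate _ k)).2 := by
    by_cases h1 : (k : ℕ) + 1 < w.length
    · have h2 := List.isChain_iff_getElem.1 hw.isReduced k h1
      have h3 : finRotate _ k = ⟨k + 1, h1⟩ := by
        ext
        rw [val_finRotate]
        exact Nat.mod_eq_of_lt h1
      rw [h3]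
      exact h2
    · have h3 : finRotate _ k = ⟨0, by omega⟩ := by
        ext
        rw [val_finRotate]
        have : (k : ℕ) + 1 = w.length := by omega
        simp [this]
      rw [h3]
      refine hw.2 _ ?_ _ ?_
      · rw [List.getLast?_eq_getElem?]
        have : w.length - 1 = k := by omega
        simp [this]
      · rw [List.head?_eq_getElem?]
        simp
  rw [h] at key
  have := key rfl
  simp [letterInv] at this

lemma val_iterate_finRotate {n : ℕ} (i : Fin n) (k : ℕ) :
    (((finRotate n)^[k] i : Fin n) : ℕ) = (i + k) % n := by
  induction k with
  | zero => exact (Nat.mod_eq_of_lt i.2).symm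
  | succ k ih => rw [Function.iterate_succ_apply', val_finRotate, ih, Nat.mod_add_mod, add_assoc]

/-- Reading a cyclically reduced word `u` cyclically, from a position back to the same position,
gives a power of `u`, up to rotation. -/
lemma exists_ofFn_isRotated_pow {α : Type*} [DecidableEq α] {u : FreeGroup α}
    (hu : IsCyclicallyReduced u.toWord) (i : Fin u.toWord.length) {c : ℕ} (hc : 0 < c)
    (h : (finRotate _)^[c] i = i) :
    ∃ m : ℕ, m ≠ 0 ∧
      (List.ofFn fun k : Fin c => u.toWord.get ((finRotate _)^[k] i)) ~r (u ^ m).toWord := by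
  have hdvd : u.toWord.length ∣ c := by
    have h1 := val_iterate_finRotate i c
    rw [h] at h1
    have h5 : (i : ℕ) + c ≡ i + 0 [MOD u.toWord.length] := by
      unfold Nat.ModEq
      rw [← h1, add_zero, Nat.mod_eq_of_lt i.2]
    exact Nat.modEq_zero_iff_dvd.1 (Nat.ModEq.add_left_cancel' _ h5)
  obtain ⟨m, hm⟩ := hdvd
  refine ⟨m, by rintro rfl; omega, ?_⟩
  rw [toWord_pow_of_isCyclicallyReduced hu]
  convert ofFn_isRotated_flatten_replicate u.toWord i.pos i m hm using 1
  congr 1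
  funext k
  simp only [List.get_eq_getElem, val_iterate_finRotate]

/-- The flags of a list of cyclic words. The corner `⟨j, i⟩` precedes the `i`-th letter of the
`j`-th word; its end `true` is the direction of that letter, and its end `false` is the direction
of the inverse of the preceding letter. -/
abbrev WordFlag {α : Type} [DecidableEq α] (U : List (FreeGroup α)) : Type :=
  (Σ j : Fin U.length, Fin (U.get j).toWord.length) × Bool

/-- The flag system of a list of cyclically reduced words. -/
def wordSystem {α : Type} [DecidableEq α] (U : List (FreeGroup α))
    (hU : ∀ u ∈ U, IsCyclicallyReduced u.toWord) : FlagSystem (WordFlag U) α where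
  across t := (t.1, !t.2)
  along
    | (⟨j, i⟩, true) => (⟨j, finRotate _ i⟩, false)
    | (⟨j, i⟩, false) => (⟨j, (finRotate _).symm i⟩, true)
  lab
    | (⟨j, i⟩, true) => (U.get j).toWord.get i
    | (⟨j, i⟩, false) => letterInv ((U.get j).toWord.get ((finRotate _).symm i))
  across_across t := by simp
  along_along := by
    rintro ⟨⟨j, i⟩, _ | _⟩
    · simp only [Equiv.apply_symm_apply]
    · simp only [Equiv.symm_apply_apply]
  lab_along := by
    rintro ⟨⟨j, i⟩, _ | _⟩
    · simp only [letterInv_letterInv]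
    · simp only [Equiv.symm_apply_apply]
  lab_across_ne := by
    have key : ∀ (j : Fin U.length) (i : Fin (U.get j).toWord.length), (U.get j).toWord.get i ≠
        letterInv ((U.get j).toWord.get ((finRotate _).symm i)) := by
      intro j i
      have := get_finRotate_ne_letterInv (hU _ (U.get_mem j)) ((finRotate _).symm i)
      rwa [Equiv.apply_symm_apply] at this
    rintro ⟨⟨j, i⟩, _ | _⟩
    · exact key j i
    · exact (key j i).symm

/-- A closed path of flags reads a power of a word of the list: a positive power if the flags are
of the kind `true`, and a negative power otherwise. -/
theorem wordSystem_ofFn_isRotated {α : Type} [DecidableEq α] (U : List (FreeGroup α))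
    (hU : ∀ u ∈ U, IsCyclicallyReduced u.toWord) (t : WordFlag U) (c : ℕ) (hc : 0 < c)
    (ht : (wordSystem U hU).next^[c] t = t) :
    ∃ u ∈ U, ∃ z : ℤ, z ≠ 0 ∧
      (List.ofFn fun k : Fin c => (wordSystem U hU).lab ((wordSystem U hU).next^[k] t)) ~r
        (u ^ z).toWord := by
  obtain ⟨⟨j, i⟩, b⟩ := t
  have hred := hU _ (U.get_mem j)
  refine ⟨U.get j, U.get_mem j, ?_⟩
  cases b
  · have hit : ∀ k, (wordSystem U hU).next^[k] (⟨j, i⟩, false) =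
        (⟨j, (finRotate _).symm^[k] i⟩, false) := by
      intro k
      induction k with
      | zero => rfl
      | succ k ih => rw [Function.iterate_succ_apply', ih, Function.iterate_succ_apply']; rfl
    have hfix : (finRotate _).symm^[c] i = i := by
      rw [hit] at ht
      simpa using ht
    have hleft : ∀ (k : ℕ) (x : Fin (U.get j).toWord.length),
        (finRotate _)^[k] ((finRotate _).symm^[k] x) = x := fun k =>
      Function.LeftInverse.iterate (finRotate _).apply_symm_apply k
    have hfix' : (finRotate _)^[c] i = i := by
      conv_lhs => rw [← hfix]
      exact hleft c i
    obtain ⟨m, hm, hrot⟩ := exists_ofFn_isRotated_pow hred i hc hfix'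
    refine ⟨-(m : ℤ), by omega, ?_⟩
    rw [zpow_neg, zpow_natCast, toWord_inv]
    -- read backwards, the path inverts the path read forwards
    convert (hrot.map fun l => (l.1, !l.2)).reverse using 1
    · refine List.ext_getElem (by simp) fun k h1 h2 => ?_
      simp only [List.length_ofFn] at h1
      simp only [List.getElem_ofFn, List.getElem_reverse, List.getElem_map, List.length_map,
        List.length_ofFn, hit]
      change letterInv ((U.get j).toWord.get _) = letterInv _
      congr 2
      apply (finRotate _).injective.iterate (k + 1)
      rw [← Function.iterate_succ_apply' (finRotate _).symm k i, hleft,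
        ← Function.iterate_add_apply]
      have : k + 1 + (c - 1 - k) = c := by omega
      rw [this, hfix']
    · rfl
  · have hit : ∀ k, (wordSystem U hU).next^[k] (⟨j, i⟩, true) =
        (⟨j, (finRotate _)^[k] i⟩, true) := by
      intro k
      induction k with
      | zero => rfl
      | succ k ih => rw [Function.iterate_succ_apply', ih, Function.iterate_succ_apply']; rfl
    have hfix : (finRotate _)^[c] i = i := by
      rw [hit] at ht
      simpa using ht
    obtain ⟨m, hm, hrot⟩ := exists_ofFn_isRotated_pow hred i hc hfix
    refine ⟨m, by omega, ?_⟩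
    rw [zpow_natCast]
    convert hrot using 1
    congr 1
    funext k
    rw [hit]
    rfl

/-! ### Whitehead automorphisms and minimality -/

/-- A letter as an element of the free group. -/
def letterElt {α : Type} (l : α × Bool) : FreeGroup α := mk [l]

lemma letterElt_letterInv {α : Type} (l : α × Bool) :
    letterElt (letterInv l) = (letterElt l)⁻¹ := by
  simp [letterElt, letterInv, inv_mk, invRev]

lemma of_eq_letterElt {α : Type} (i : α) : of i = letterElt (i, true) := rfl

lemma eq_or_eq_letterInv {α : Type} {l a : α × Bool} (h : l.1 = a.1) : l = a ∨ l = letterInv a := by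
  obtain ⟨i, s⟩ := l
  obtain ⟨j, t⟩ := a
  simp only at h
  subst h
  cases s <;> cases t <;> simp [letterInv]

lemma map_mk_eq_prod {α : Type} {M : Type*} [Group M] (φ : FreeGroup α →* M) (w : List (α × Bool)) :
    φ (mk w) = (w.map fun l => φ (letterElt l)).prod := by
  induction w with
  | nil => simp [← one_eq_mk]
  | cons l w ih =>
    have : mk (l :: w) = letterElt l * mk w := by simp [letterElt, mul_mk]
    rw [this, _root_.map_mul, ih, List.map_cons, List.prod_cons]

section Whitehead

variable {α : Type} [DecidableEq α]

lemma norm_pow_eq (g : FreeGroup α) (n : ℕ) : norm (g ^ (n + 1)) =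
    2 * (reduceCyclically.conjugator g.toWord).length + (n + 1) * cyclicLength g := by
  rw [FreeGroup.norm, FreeGroup.toWord_pow,
    reduceCyclically.reduce_flatten_replicate_succ isReduced_toWord]
  simp only [List.length_append, List.length_flatten, List.map_replicate, List.sum_replicate,
    invRev_length, smul_eq_mul, cyclicLength]
  ring

lemma norm_pow_le (g : FreeGroup α) (n : ℕ) : norm (g ^ n) ≤ n * norm g := by
  induction n with
  | zero => simp
  | succ n ih =>
    rw [pow_succ]
    have := norm_mul_le (g ^ n) g
    linarith

/-- The cyclic length is a lower bound for the lengths of all conjugates, as the comparison of the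
growth of the lengths of the powers shows. -/
lemma cyclicLength_le_norm_conj (g h : FreeGroup α) : cyclicLength g ≤ norm (h⁻¹ * g * h) := by
  by_contra! hlt
  have h1 := norm_pow_eq g (2 * norm h)
  have h2 : g ^ (2 * norm h + 1) = h * (h⁻¹ * g * h) ^ (2 * norm h + 1) * h⁻¹ := by
    rw [← conj_pow]
    group
  have h3 := norm_mul_le (h * (h⁻¹ * g * h) ^ (2 * norm h + 1)) h⁻¹
  have h4 := norm_mul_le h ((h⁻¹ * g * h) ^ (2 * norm h + 1))
  have h5 := norm_pow_le (h⁻¹ * g * h) (2 * norm h + 1)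
  rw [← h2, norm_inv_eq] at h3
  have h6 := Nat.mul_le_mul_left (2 * norm h + 1) hlt
  rw [Nat.succ_eq_add_one, mul_add] at h6
  omega

lemma cyclicLength_of_isCyclicallyReduced {u : FreeGroup α}
    (hu : IsCyclicallyReduced u.toWord) : cyclicLength u = u.toWord.length := by
  have h1 := norm_pow_eq u 0
  have h2 := norm_pow_eq u 1
  rw [FreeGroup.norm, toWord_pow_of_isCyclicallyReduced hu] at h1 h2
  simp only [List.length_flatten, List.map_replicate, List.sum_replicate, smul_eq_mul] at h1 h2
  omega

lemma norm_letterElt_zpow_le (l : α × Bool) (z : ℤ) : norm (letterElt l ^ z) ≤ z.natAbs := by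
  have h : norm (letterElt l) ≤ 1 := norm_mk_le
  have key : ∀ n : ℕ, norm (letterElt l ^ n) ≤ n := fun n =>
    (norm_pow_le _ n).trans (by simpa using Nat.mul_le_mul_left n h)
  rcases Int.natAbs_eq z with hz | hz
  · rw [hz, zpow_natCast, Int.natAbs_natCast]
    exact key _
  · rw [hz, zpow_neg, norm_inv_eq, zpow_natCast, Int.natAbs_neg, Int.natAbs_natCast]
    exact key _

/-- The endomorphism which multiplies the letter `b` by the letter `a` on the left and fixes the
generators other than that of `b`. -/
def whiteheadHom (a b : α × Bool) : FreeGroup α →* FreeGroup α :=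
  lift fun i => if i = b.1 then
    (if b.2 then letterElt a * of i else of i * (letterElt a)⁻¹) else of i

lemma whiteheadHom_letterElt_of_ne {a b l : α × Bool} (h : l.1 ≠ b.1) :
    whiteheadHom a b (letterElt l) = letterElt l := by
  obtain ⟨i, s⟩ := l
  simp only at h
  have h1 : whiteheadHom a b (letterElt (i, true)) = letterElt (i, true) := by
    rw [← of_eq_letterElt, whiteheadHom, lift_apply_of, if_neg h]
  cases s
  · have : ((i, false) : α × Bool) = letterInv (i, true) := rfl
    rw [this, letterElt_letterInv, _root_.map_inv, h1]
  · exact h1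

lemma whiteheadHom_letterElt_self (a b : α × Bool) :
    whiteheadHom a b (letterElt b) = letterElt a * letterElt b := by
  obtain ⟨i, s⟩ := b
  cases s
  · have : ((i, false) : α × Bool) = letterInv (i, true) := rfl
    rw [this, letterElt_letterInv, _root_.map_inv, ← of_eq_letterElt, whiteheadHom, lift_apply_of]
    simp [letterInv]
  · rw [← of_eq_letterElt, whiteheadHom, lift_apply_of]
    simp

lemma whiteheadHom_comp {a b : α × Bool} (h : a.1 ≠ b.1) :
    (whiteheadHom (letterInv a) b).comp (whiteheadHom a b) = MonoidHom.id _ := by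
  refine ext_hom _ _ fun i => ?_
  have key : ∀ l, (whiteheadHom (letterInv a) b) (whiteheadHom a b (letterElt l)) =
      letterElt l := by
    intro l
    by_cases hl : l.1 = b.1
    · have hb : (whiteheadHom (letterInv a) b) (whiteheadHom a b (letterElt b)) =
          letterElt b := by
        rw [whiteheadHom_letterElt_self, _root_.map_mul, whiteheadHom_letterElt_of_ne h,
          whiteheadHom_letterElt_self, letterElt_letterInv, mul_inv_cancel_left]
      rcases eq_or_eq_letterInv hl with rfl | rfl
      · exact hb
      · rw [letterElt_letterInv, _root_.map_inv, _root_.map_inv, hb]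
    · rw [whiteheadHom_letterElt_of_ne hl, whiteheadHom_letterElt_of_ne hl]
  exact key (i, true)

/-- The Whitehead automorphism multiplying the letter `b` by the letter `a` on the left. -/
def whiteheadAut {a b : α × Bool} (h : a.1 ≠ b.1) : FreeGroup α ≃* FreeGroup α :=
  MonoidHom.toMulEquiv (whiteheadHom a b) (whiteheadHom (letterInv a) b) (whiteheadHom_comp h) (by
    have := whiteheadHom_comp (a := letterInv a) (b := b) h
    rwa [letterInv_letterInv] at this)

/-- The indicator function of the set `{a, b}` of letters. -/
def cutInd (a b l : α × Bool) : ℤ := if l = a ∨ l = b then 1 else 0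

/-- All letters are transformed by the same rule: conjugating powers of `a` which depend on the
letter are attached to the two ends, and the letters `a`, `a⁻¹` themselves are dropped. -/
lemma whiteheadHom_letterElt {a b : α × Bool} (h : a.1 ≠ b.1) (l : α × Bool) :
    whiteheadHom a b (letterElt l) = letterElt a ^ cutInd a b l *
      (if l.1 = a.1 then 1 else letterElt l) * letterElt a ^ (-cutInd a b (letterInv l)) := by
  have hab : ∀ l : α × Bool, l.1 = a.1 → l ≠ b := fun l hl e => h (by rw [← hl, e])
  have hba : ∀ l : α × Bool, l.1 = b.1 → l ≠ a := fun l hl e => h (by rw [← hl, e])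
  by_cases h1 : l.1 = a.1
  · rw [if_pos h1, whiteheadHom_letterElt_of_ne (by rw [h1]; exact h)]
    rcases eq_or_eq_letterInv h1 with rfl | rfl
    · simp [cutInd, letterInv_ne, hab (letterInv l) rfl]
    · simp [cutInd, letterInv_ne, hab (letterInv a) rfl, letterElt_letterInv]
  · rw [if_neg h1]
    have h1' : ∀ l' : α × Bool, l'.1 ≠ a.1 → l' ≠ a := fun l' hl e => hl (by rw [e])
    by_cases h2 : l.1 = b.1
    · rcases eq_or_eq_letterInv h2 with rfl | rfl
      · rw [whiteheadHom_letterElt_self]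
        simp [cutInd, letterInv_ne, hba (letterInv l) rfl]
      · rw [letterElt_letterInv, _root_.map_inv, whiteheadHom_letterElt_self]
        simp [cutInd, letterInv_ne, hba (letterInv b) rfl]
    · have h2' : ∀ l' : α × Bool, l'.1 ≠ b.1 → l' ≠ b := fun l' hl e => hl (by rw [e])
      rw [whiteheadHom_letterElt_of_ne h2]
      simp [cutInd, h1' l h1, h1' (letterInv l) h1, h2' l h2, h2' (letterInv l) h2]

/-- The contribution of a letter `l` and the letter `l'` following it to the length of the image
of a cyclic word under a Whitehead automorphism. -/
def whiteheadCost (a b l l' : α × Bool) : ℕ :=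
  (if l.1 = a.1 then 0 else 1) + (cutInd a b l' - cutInd a b (letterInv l)).natAbs

lemma cyclicLength_whiteheadHom_le {a b : α × Bool} (h : a.1 ≠ b.1) (u : FreeGroup α) :
    cyclicLength (whiteheadHom a b u) ≤
      ∑ i, whiteheadCost a b (u.toWord.get i) (u.toWord.get (finRotate _ i)) := by
  rcases Nat.eq_zero_or_pos u.toWord.length with h0 | hn
  · have : u = 1 := by
      rw [← toWord_eq_nil_iff]
      exact List.length_eq_zero_iff.1 h0
    subst this
    simp [cyclicLength]
  let x : ℕ → α × Bool := fun k => u.toWord[k % u.toWord.length]'(Nat.mod_lt _ hn)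
  have hx : ∀ k (hk : k < u.toWord.length), x k = u.toWord[k] := fun k hk => by
    simp only [x, Nat.mod_eq_of_lt hk]
  -- Conjugated suitably, the image of each initial segment is as short as claimed.
  have key : ∀ k ≤ u.toWord.length,
      norm ((letterElt a ^ cutInd a b (x 0))⁻¹ *
        ((u.toWord.take k).map fun l => whiteheadHom a b (letterElt l)).prod *
        letterElt a ^ cutInd a b (x k)) ≤
      ∑ j ∈ Finset.range k, whiteheadCost a b (x j) (x (j + 1)) := by
    intro k
    induction k with
    | zero => simp
    | succ k ih =>
      intro hk
      rw [Finset.sum_range_succ, ← List.take_concat_get' _ k (by omega), List.map_append,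
        List.prod_append, List.map_singleton, List.prod_singleton, ← hx k (by omega),
        whiteheadHom_letterElt h]
      set p := ((u.toWord.take k).map fun l => whiteheadHom a b (letterElt l)).prod
      have e : (letterElt a ^ cutInd a b (x 0))⁻¹ * (p * (letterElt a ^ cutInd a b (x k) *
          (if (x k).1 = a.1 then 1 else letterElt (x k)) *
          letterElt a ^ (-cutInd a b (letterInv (x k))))) * letterElt a ^ cutInd a b (x (k + 1)) =
          ((letterElt a ^ cutInd a b (x 0))⁻¹ * p * letterElt a ^ cutInd a b (x k)) *
          ((if (x k).1 = a.1 then 1 else letterElt (x k)) *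
          letterElt a ^ (cutInd a b (x (k + 1)) - cutInd a b (letterInv (x k)))) := by
        rw [sub_eq_neg_add, zpow_add]
        simp only [mul_assoc]
      rw [e]
      refine (FreeGroup.norm_mul_le _ _).trans (add_le_add (ih (by omega)) ?_)
      refine (FreeGroup.norm_mul_le _ _).trans (add_le_add ?_ (norm_letterElt_zpow_le _ _))
      split_ifs
      · simp
      · exact norm_mk_le
  have h1 := key _ le_rfl
  have h2 : x u.toWord.length = x 0 := by simp [x]
  rw [List.take_length, ← map_mk_eq_prod, mk_toWord, h2] at h1
  refine (cyclicLength_le_norm_conj _ _).trans (h1.trans (le_of_eq ?_))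
  rw [Finset.sum_range]
  refine Finset.sum_congr rfl fun i _ => ?_
  rw [hx i i.2]
  simp only [x, List.get_eq_getElem, val_finRotate]

/-- Minimality bounds the degree of a letter `a` in the Whitehead graph by the number of edges
leaving the set of vertices `{a, b}`. -/
theorem card_le_card_cut_of_isMinimal (U : List (FreeGroup α))
    (hU : ∀ u ∈ U, IsCyclicallyReduced u.toWord) (hmin : IsMinimal U) {a b : α × Bool}
    (h : a.1 ≠ b.1) :
    (Finset.univ.filter fun t => (wordSystem U hU).lab t = a).card ≤
      (Finset.univ.filter fun t => ((wordSystem U hU).lab t = a ∨ (wordSystem U hU).lab t = b) ∧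
        ¬ ((wordSystem U hU).lab ((wordSystem U hU).across t) = a ∨
          (wordSystem U hU).lab ((wordSystem U hU).across t) = b)).card := by
  have h1 := hmin (whiteheadAut h)
  rw [← List.ofFn_get U] at h1
  simp only [List.map_ofFn, List.sum_ofFn, Function.comp_apply] at h1
  have h2 : ∑ j, (U.get j).toWord.length ≤ ∑ j, ∑ i, whiteheadCost a b
      ((U.get j).toWord.get i) ((U.get j).toWord.get (finRotate _ i)) := by
    refine le_trans (le_of_eq ?_) (h1.trans ?_)
    · exact Finset.sum_congr rfl fun j _ =>
        (cyclicLength_of_isCyclicallyReduced (hU _ (U.get_mem j))).symm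
    · exact Finset.sum_le_sum fun j _ => cyclicLength_whiteheadHom_le h (U.get j)
  set S := wordSystem U hU
  have ht : ∀ j i, S.lab (⟨j, i⟩, true) = (U.get j).toWord.get i := fun j i => rfl
  have hf : ∀ j i, S.lab (⟨j, finRotate _ i⟩, false) = letterInv ((U.get j).toWord.get i) := by
    intro j i
    change letterInv ((U.get j).toWord.get ((finRotate _).symm (finRotate _ i))) = _
    rw [Equiv.symm_apply_apply]
  have hdeg : (Finset.univ.filter fun t => S.lab t = a).card =
      ∑ j, ∑ i, if ((U.get j).toWord.get i).1 = a.1 then 1 else 0 := by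
    rw [Finset.card_filter, Fintype.sum_prod_type, Fintype.sum_sigma]
    refine Finset.sum_congr rfl fun j _ => ?_
    simp only [Fintype.sum_bool]
    rw [Finset.sum_add_distrib, ← Equiv.sum_comp (finRotate _) fun i =>
      if S.lab (⟨j, i⟩, false) = a then 1 else 0, ← Finset.sum_add_distrib]
    refine Finset.sum_congr rfl fun i _ => ?_
    rw [ht, hf]
    by_cases h3 : ((U.get j).toWord.get i).1 = a.1
    · rw [if_pos h3]
      rcases eq_or_eq_letterInv h3 with h4 | h4
      · rw [h4]; simp [letterInv_ne]
      · rw [h4]; simp [letterInv_ne]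
    · rw [if_neg h3, if_neg (fun h4 => h3 (by rw [h4])), if_neg (fun h4 => h3 (by rw [← h4]; rfl))]
  have hcut : (Finset.univ.filter fun t => (S.lab t = a ∨ S.lab t = b) ∧
      ¬ (S.lab (S.across t) = a ∨ S.lab (S.across t) = b)).card =
      ∑ j, ∑ i, (cutInd a b ((U.get j).toWord.get (finRotate _ i)) -
        cutInd a b (letterInv ((U.get j).toWord.get i))).natAbs := by
    rw [Finset.card_filter, Fintype.sum_prod_type, Fintype.sum_sigma]
    refine Finset.sum_congr rfl fun j _ => ?_
    simp only [Fintype.sum_bool]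
    rw [← Equiv.sum_comp (finRotate _)]
    refine Finset.sum_congr rfl fun i _ => ?_
    have h3 : ∀ b : Bool, S.across (⟨j, finRotate _ i⟩, b) = (⟨j, finRotate _ i⟩, !b) :=
      fun b => rfl
    rw [h3, h3, Bool.not_true, Bool.not_false, ht, hf]
    unfold cutInd
    generalize (U.get j).toWord.get (finRotate _ i) = l
    generalize letterInv ((U.get j).toWord.get i) = l'
    split_ifs <;> first | rfl | (exfalso; tauto)
  rw [hdeg, hcut]
  have h3 : ∑ j, ∑ i, whiteheadCost a b
        ((U.get j).toWord.get i) ((U.get j).toWord.get (finRotate _ i)) +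
      (∑ j, ∑ i, if ((U.get j).toWord.get i).1 = a.1 then 1 else 0) =
      ∑ j, (U.get j).toWord.length + ∑ j, ∑ i,
        (cutInd a b ((U.get j).toWord.get (finRotate _ i)) -
          cutInd a b (letterInv ((U.get j).toWord.get i))).natAbs := by
    rw [← Finset.sum_add_distrib, ← Finset.sum_add_distrib]
    refine Finset.sum_congr rfl fun j _ => ?_
    have h4 : (U.get j).toWord.length = ∑ _i : Fin (U.get j).toWord.length, 1 := by simp
    refine Eq.trans ?_ (congrArg (· + _) h4.symm)
    rw [← Finset.sum_add_distrib, ← Finset.sum_add_distrib]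
    refine Finset.sum_congr rfl fun i _ => ?_
    unfold whiteheadCost
    split_ifs <;> omega
  omega

end Whitehead

/-! ### Diskbusting lists -/

/-- The free group of rank two is the free product of the cyclic groups generated by its two
generators. -/
lemma isFreeProduct_zpowers_of :
    IsFreeProduct (Subgroup.zpowers (of (0 : Fin 2))) (Subgroup.zpowers (of (1 : Fin 2))) := by
  set A := Subgroup.zpowers (of (0 : Fin 2))
  set B := Subgroup.zpowers (of (1 : Fin 2))
  let f : Monoid.Coprod A B →* FreeGroup (Fin 2) := Monoid.Coprod.lift A.subtype B.subtype
  let a0 : A := ⟨of 0, Subgroup.mem_zpowers _⟩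
  let b0 : B := ⟨of 1, Subgroup.mem_zpowers _⟩
  let g : FreeGroup (Fin 2) →* Monoid.Coprod A B :=
    lift fun i => if i = 0 then Monoid.Coprod.inl a0 else Monoid.Coprod.inr b0
  have hg0 : g (of 0) = Monoid.Coprod.inl a0 := by simp [g]
  have hg1 : g (of 1) = Monoid.Coprod.inr b0 := by simp [g]
  have h1 : f.comp g = MonoidHom.id _ := by
    refine ext_hom _ _ fun i => ?_
    fin_cases i
    · change f (g (of 0)) = of 0
      rw [hg0]
      simp [f, a0]
    · change f (g (of 1)) = of 1
      rw [hg1]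
      simp [f, b0]
  have h2 : g.comp f = MonoidHom.id _ := by
    apply Monoid.Coprod.hom_ext
    · ext ⟨x, k, rfl⟩
      have hx : (⟨of 0 ^ k, k, rfl⟩ : A) = a0 ^ k := Subtype.ext (by simp [a0])
      change g (f (Monoid.Coprod.inl _)) = Monoid.Coprod.inl _
      have : f (Monoid.Coprod.inl ⟨of 0 ^ k, k, rfl⟩) = of 0 ^ k := by simp [f]
      rw [this, _root_.map_zpow, hg0, ← _root_.map_zpow, hx]
    · ext ⟨x, k, rfl⟩
      have hx : (⟨of 1 ^ k, k, rfl⟩ : B) = b0 ^ k := Subtype.ext (by simp [b0])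
      change g (f (Monoid.Coprod.inr _)) = Monoid.Coprod.inr _
      have : f (Monoid.Coprod.inr ⟨of 1 ^ k, k, rfl⟩) = of 1 ^ k := by simp [f]
      rw [this, _root_.map_zpow, hg1, ← _root_.map_zpow, hx]
  exact Function.bijective_iff_has_inverse.2
    ⟨g, fun x => DFunLike.congr_fun h2 x, fun x => DFunLike.congr_fun h1 x⟩

lemma mem_zpowers_of_forall_fst {α : Type} [DecidableEq α] {u : FreeGroup α} {i : α}
    (h : ∀ l ∈ u.toWord, l.1 = i) : u ∈ Subgroup.zpowers (of i) := by
  have h1 := map_mk_eq_prod (MonoidHom.id (FreeGroup α)) u.toWord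
  rw [mk_toWord] at h1
  change u = _ at h1
  rw [h1]
  refine Subgroup.list_prod_mem _ fun x hx => ?_
  obtain ⟨⟨j, s⟩, hl, rfl⟩ := List.mem_map.1 hx
  obtain rfl : j = i := h _ hl
  change letterElt (j, s) ∈ _
  cases s
  · have : ((j, false) : α × Bool) = letterInv (j, true) := rfl
    rw [this, letterElt_letterInv]
    exact inv_mem (Subgroup.mem_zpowers _)
  · exact Subgroup.mem_zpowers _

/-- In a diskbusting list some word involves both generators, as otherwise the free product
decomposition into the two cyclic groups generated by them would contradict the definition. -/
theorem exists_fst_ne_of_isDiskbusting (U : List (FreeGroup (Fin 2)))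
    (hU : ∀ u ∈ U, IsCyclicallyReduced u.toWord) (hdisk : IsDiskbusting U) :
    ∃ t, ((wordSystem U hU).lab t).1 ≠
      ((wordSystem U hU).lab ((wordSystem U hU).across t)).1 := by
  by_contra! hall
  have hne : ∀ i : Fin 2, Subgroup.zpowers (of i) ≠ ⊥ := fun i => by
    rw [Ne, Subgroup.zpowers_eq_bot]
    exact of_ne_one i
  refine hdisk ⟨_, _, hne 0, hne 1, isFreeProduct_zpowers_of, fun u hu => ?_⟩
  have key : ∃ i : Fin 2, ∀ l ∈ u.toWord, l.1 = i := by
    obtain ⟨j, rfl⟩ := List.get_of_mem hu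
    rcases Nat.eq_zero_or_pos (U.get j).toWord.length with h0 | hn
    · refine ⟨0, fun l hl => ?_⟩
      rw [List.length_eq_zero_iff.1 h0] at hl
      simp at hl
    have hstep : ∀ i, ((U.get j).toWord.get (finRotate _ i)).1 = ((U.get j).toWord.get i).1 := by
      intro i
      have h1 : ((U.get j).toWord.get (finRotate _ i)).1 =
        ((U.get j).toWord.get ((finRotate _).symm (finRotate _ i))).1 :=
        hall (⟨j, finRotate _ i⟩, true)
      rwa [Equiv.symm_apply_apply] at h1
    refine ⟨((U.get j).toWord.get ⟨0, hn⟩).1, fun l hl => ?_⟩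
    obtain ⟨i, rfl⟩ := List.get_of_mem hl
    have hit : ∀ k, ((U.get j).toWord.get ((finRotate _)^[k] ⟨0, hn⟩)).1 =
        ((U.get j).toWord.get ⟨0, hn⟩).1 := by
      intro k
      induction k with
      | zero => rfl
      | succ k ih => rw [Function.iterate_succ_apply', hstep, ih]
    rw [← hit i]
    congr 2
    ext
    rw [val_iterate_finRotate, Nat.mod_eq_of_lt (by simp)]
    simp
  obtain ⟨i, hi⟩ := key
  have := mem_zpowers_of_forall_fst hi
  fin_cases i
  · exact Or.inl ⟨1, by simpa using this⟩
  · exact Or.inr ⟨1, by simpa using this⟩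

/-! ### Families of links and their total pair sums -/

namespace FlagSystem

section Families

variable {W β : Type} {S : FlagSystem W β}

/-- The sum of the pair sums of the members of a family of links. For the indicator function of
`(t, t')` this counts the places where the flags `t` and `t'` are adjacent, in this order. -/
def total (𝓒 : Multiset S.Link) (Φ : W → W → ℤ) : ℤ := (𝓒.map fun C => C.pairSum Φ).sum

lemma total_add (𝓒 𝓓 : Multiset S.Link) (Φ : W → W → ℤ) :
    total (𝓒 + 𝓓) Φ = total 𝓒 Φ + total 𝓓 Φ := by
  simp [total]

lemma total_nsmul (n : ℕ) (𝓒 : Multiset S.Link) (Φ : W → W → ℤ) :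
    total (n • 𝓒) Φ = n * total 𝓒 Φ := by
  simp [total, Multiset.map_nsmul, Multiset.sum_nsmul]

lemma total_sum {J : Type*} (s : Finset J) (𝓒 : J → Multiset S.Link) (Φ : W → W → ℤ) :
    total (∑ j ∈ s, 𝓒 j) Φ = ∑ j ∈ s, total (𝓒 j) Φ := by
  classical
  induction s using Finset.induction_on with
  | empty => simp [total]
  | insert j s hj ih => rw [Finset.sum_insert hj, Finset.sum_insert hj, total_add, ih]

lemma total_map {J : Type*} [Fintype J] (f : J → S.Link) (Φ : W → W → ℤ) :
    total (Finset.univ.val.map f) Φ = ∑ j, (f j).pairSum Φ := by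
  simp only [total, Multiset.map_map]
  rfl

/-- With both directions of each link included, a family whose total pair sum is invariant under
`along`, for symmetric functions, is balanced. -/
theorem exists_immersion_of_total_eq (𝓒 : Multiset S.Link)
    (h : ∀ Φ : W → W → ℤ, (∀ t t', Φ t t' = Φ t' t) →
      total 𝓒 Φ = total 𝓒 fun t t' => Φ (S.along t) (S.along t'))
    (h3 : ∃ C ∈ 𝓒, 3 ≤ C.n) :
    ∃ (P : SidePairing) (f : P.Immersion β),
      (∀ i, ∃ t : W, S.next^[P.sides i] t = t ∧
        f.boundaryWord i = List.ofFn fun k : Fin (P.sides i) => S.lab (S.next^[k] t)) ∧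
      P.eulerChar < P.m := by
  let C : Fin 𝓒.toList.length → S.Link := fun i => 𝓒.toList.get i
  have hC : ∀ Φ, ∑ i, (C i).pairSum Φ = total 𝓒 Φ := by
    intro Φ
    conv_rhs => rw [← Multiset.coe_toList 𝓒, ← List.ofFn_get 𝓒.toList]
    simp only [total, Multiset.map_coe, Multiset.sum_coe, List.map_ofFn, List.sum_ofFn]
    rfl
  let C' : Fin 𝓒.toList.length ⊕ Fin 𝓒.toList.length → S.Link :=
    Sum.elim C fun i => (C i).reverse
  have hadd : ∀ (D : S.Link) (Φ Ψ : W → W → ℤ),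
      D.pairSum Φ + D.pairSum Ψ = D.pairSum fun t t' => Φ t t' + Ψ t t' :=
    fun D Φ Ψ => Finset.sum_add_distrib.symm
  have hC' : ∀ Φ, ∑ i, (C' i).pairSum Φ = total 𝓒 fun t t' => Φ t t' + Φ t' t := by
    intro Φ
    rw [Fintype.sum_sum_type, ← hC, ← Finset.sum_add_distrib]
    refine Finset.sum_congr rfl fun i _ => ?_
    simp only [C', Sum.elim_inl, Sum.elim_inr]
    rw [Link.pairSum_reverse, hadd]
  refine exists_immersion_of_isBalanced C' (fun Φ => ?_) ?_
  · rw [hC', hC', h _ fun t t' => add_comm _ _]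
    congr 1
    funext t t'
    exact add_comm _ _
  · obtain ⟨D, hD, hn⟩ := h3
    obtain ⟨i, hi⟩ := List.get_of_mem (Multiset.mem_toList.2 hD)
    exact ⟨Sum.inl i, by simpa [C', C] using (by rw [← hi] at hn; simpa using hn)⟩

/-- The link with two edges. -/
def Link.bigon (t₁ t₂ : W) (h₁ : S.lab (S.across t₁) = S.lab t₂)
    (h₂ : S.lab (S.across t₂) = S.lab t₁) : S.Link where
  n := 2
  two_le := le_rfl
  flag := ![t₁, t₂]
  lab_injective := by
    have h := S.lab_across_ne t₁
    rw [h₁] at h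
    intro i j
    fin_cases i <;> fin_cases j <;> simp [h, h.symm]
  lab_across k := by
    fin_cases k
    · exact h₁
    · exact h₂

/-- The link with three edges. -/
def Link.triangle (t₁ t₂ t₃ : W) (h₁ : S.lab (S.across t₁) = S.lab t₂)
    (h₂ : S.lab (S.across t₂) = S.lab t₃) (h₃ : S.lab (S.across t₃) = S.lab t₁) : S.Link where
  n := 3
  two_le := by norm_num
  flag := ![t₁, t₂, t₃]
  lab_injective := by
    have h := S.lab_across_ne t₁
    rw [h₁] at h
    have h' := S.lab_across_ne t₂
    rw [h₂] at h'
    have h'' := S.lab_across_ne t₃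
    rw [h₃] at h''
    intro i j
    fin_cases i <;> fin_cases j <;> simp [h, h.symm, h', h'.symm, h'', h''.symm]
  lab_across k := by
    fin_cases k
    · exact h₁
    · exact h₂
    · exact h₃

/-- The link with four edges. -/
def Link.quad (t₁ t₂ t₃ t₄ : W) (h₁ : S.lab (S.across t₁) = S.lab t₂)
    (h₂ : S.lab (S.across t₂) = S.lab t₃) (h₃ : S.lab (S.across t₃) = S.lab t₄)
    (h₄ : S.lab (S.across t₄) = S.lab t₁) (h₁₃ : S.lab t₁ ≠ S.lab t₃)
    (h₂₄ : S.lab t₂ ≠ S.lab t₄) : S.Link where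
  n := 4
  two_le := by norm_num
  flag := ![t₁, t₂, t₃, t₄]
  lab_injective := by
    have h := S.lab_across_ne t₁
    rw [h₁] at h
    have h' := S.lab_across_ne t₂
    rw [h₂] at h'
    have h'' := S.lab_across_ne t₃
    rw [h₃] at h''
    have h''' := S.lab_across_ne t₄
    rw [h₄] at h'''
    intro i j
    fin_cases i <;> fin_cases j <;>
      simp [h, h.symm, h', h'.symm, h'', h''.symm, h''', h'''.symm, h₁₃, h₁₃.symm, h₂₄, h₂₄.symm]
  lab_across k := by
    fin_cases k
    · exact h₁
    · exact h₂
    · exact h₃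
    · exact h₄

lemma Link.pairSum_bigon {t₁ t₂ : W} (h₁ : S.lab (S.across t₁) = S.lab t₂)
    (h₂ : S.lab (S.across t₂) = S.lab t₁) (Φ : W → W → ℤ) :
    (Link.bigon t₁ t₂ h₁ h₂).pairSum Φ = Φ (S.across t₁) t₂ + Φ (S.across t₂) t₁ := by
  simp only [Link.pairSum, Link.bigon]
  exact Fin.sum_univ_two _

lemma Link.pairSum_triangle {t₁ t₂ t₃ : W} (h₁ : S.lab (S.across t₁) = S.lab t₂)
    (h₂ : S.lab (S.across t₂) = S.lab t₃) (h₃ : S.lab (S.across t₃) = S.lab t₁)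
    (Φ : W → W → ℤ) :
    (Link.triangle t₁ t₂ t₃ h₁ h₂ h₃).pairSum Φ =
      Φ (S.across t₁) t₂ + Φ (S.across t₂) t₃ + Φ (S.across t₃) t₁ := by
  simp only [Link.pairSum, Link.triangle]
  exact Fin.sum_univ_three _

lemma Link.pairSum_quad {t₁ t₂ t₃ t₄ : W} (h₁ : S.lab (S.across t₁) = S.lab t₂)
    (h₂ : S.lab (S.across t₂) = S.lab t₃) (h₃ : S.lab (S.across t₃) = S.lab t₄)
    (h₄ : S.lab (S.across t₄) = S.lab t₁) (h₁₃ : S.lab t₁ ≠ S.lab t₃)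
    (h₂₄ : S.lab t₂ ≠ S.lab t₄) (Φ : W → W → ℤ) :
    (Link.quad t₁ t₂ t₃ t₄ h₁ h₂ h₃ h₄ h₁₃ h₂₄).pairSum Φ =
      Φ (S.across t₁) t₂ + Φ (S.across t₂) t₃ + Φ (S.across t₃) t₄ + Φ (S.across t₄) t₁ := by
  simp only [Link.pairSum, Link.quad]
  exact Fin.sum_univ_four _

end Families

section Edges

variable {W β : Type} [Fintype W] [DecidableEq β] (S : FlagSystem W β)

/-- The flags labelled `l` whose opposite end is labelled `m`; they stand for the edges of the
Whitehead graph which join `l` to `m`. -/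
def edges (l m : β × Bool) : Finset W :=
  Finset.univ.filter fun t => S.lab t = l ∧ S.lab (S.across t) = m

/-- The number of edges of the Whitehead graph which join `l` to `m`. -/
def mult (l m : β × Bool) : ℕ := (S.edges l m).card

variable {S}

lemma mem_edges {l m : β × Bool} {t : W} :
    t ∈ S.edges l m ↔ S.lab t = l ∧ S.lab (S.across t) = m := by
  simp [edges]

lemma lab_of_edges {l m : β × Bool} (t : S.edges l m) : S.lab t.1 = l := (mem_edges.1 t.2).1

lemma lab_across_of_edges {l m : β × Bool} (t : S.edges l m) : S.lab (S.across t.1) = m :=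
  (mem_edges.1 t.2).2

variable (S)

lemma sum_edges_across {M : Type*} [AddCommMonoid M] (l m : β × Bool) (f : W → M) :
    ∑ t ∈ S.edges l m, f (S.across t) = ∑ t ∈ S.edges m l, f t := by
  refine Finset.sum_nbij' S.across S.across ?_ ?_ ?_ ?_ ?_
  · intro t ht
    rw [mem_edges] at ht ⊢
    rw [S.across_across]
    exact ht.symm
  · intro t ht
    rw [mem_edges] at ht ⊢
    rw [S.across_across]
    exact ht.symm
  · exact fun t _ => S.across_across t
  · exact fun t _ => S.across_across t
  · exact fun t _ => rfl

lemma mult_comm (l m : β × Bool) : S.mult l m = S.mult m l := by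
  have := S.sum_edges_across l m fun _ => 1
  simpa [mult] using this

/-- The sum of `Φ` over the pairs consisting of an edge from `l` to `m` and an edge from `l` to
`m'`. -/
def pairs (Φ : W → W → ℤ) (l m m' : β × Bool) : ℤ :=
  ∑ t ∈ S.edges l m, ∑ t' ∈ S.edges l m', Φ t t'

variable {S}

lemma pairs_comm {Φ : W → W → ℤ} (hΦ : ∀ t t', Φ t t' = Φ t' t) (l m m' : β × Bool) :
    S.pairs Φ l m m' = S.pairs Φ l m' m := by
  unfold pairs
  rw [Finset.sum_comm]
  exact Finset.sum_congr rfl fun t _ => Finset.sum_congr rfl fun t' _ => hΦ _ _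

lemma pairs_eq_zero_left {Φ : W → W → ℤ} {l m m' : β × Bool} (h : S.mult l m = 0) :
    S.pairs Φ l m m' = 0 := by
  rw [pairs, Finset.card_eq_zero.1 h, Finset.sum_empty]

lemma pairs_eq_zero_right {Φ : W → W → ℤ} {l m m' : β × Bool} (h : S.mult l m' = 0) :
    S.pairs Φ l m m' = 0 := by
  rw [pairs, Finset.card_eq_zero.1 h]
  simp

variable (S)

/-- All bigons on the letters `l` and `m`. -/
def bigons (l m : β × Bool) : Multiset S.Link :=
  (Finset.univ : Finset (S.edges l m × S.edges m l)).val.map fun x =>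
    Link.bigon x.1.1 x.2.1 (by rw [lab_across_of_edges, lab_of_edges])
      (by rw [lab_across_of_edges, lab_of_edges])

lemma total_bigons {Φ : W → W → ℤ} (l m : β × Bool) :
    total (S.bigons l m) Φ = S.pairs Φ l m m + S.pairs Φ m l l := by
  rw [bigons, total_map]
  simp only [Link.pairSum_bigon, Finset.sum_add_distrib, Fintype.sum_prod_type]
  have h1 : ∑ x : S.edges l m, ∑ y : S.edges m l, Φ (S.across x.1) y.1 = S.pairs Φ m l l := by
    rw [Finset.sum_coe_sort (S.edges l m) fun x => ∑ y : S.edges m l, Φ (S.across x) y.1,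
      S.sum_edges_across l m fun x => ∑ y : S.edges m l, Φ x y.1]
    exact Finset.sum_congr rfl fun t _ => Finset.sum_coe_sort (S.edges m l) _
  have h2 : ∑ x : S.edges l m, ∑ y : S.edges m l, Φ (S.across y.1) x.1 = S.pairs Φ l m m := by
    rw [Finset.sum_comm,
      Finset.sum_coe_sort (S.edges m l) fun x => ∑ y : S.edges l m, Φ (S.across x) y.1,
      S.sum_edges_across m l fun x => ∑ y : S.edges l m, Φ x y.1]
    exact Finset.sum_congr rfl fun t _ => Finset.sum_coe_sort (S.edges l m) _
  rw [h1, h2, add_comm]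

/-- All cycles of length four through the letters `l₁`, `l₂`, `l₃`, `l₄`, in this order. -/
def quads (l₁ l₂ l₃ l₄ : β × Bool) (h₁₃ : l₁ ≠ l₃) (h₂₄ : l₂ ≠ l₄) : Multiset S.Link :=
  (Finset.univ : Finset ((S.edges l₁ l₂ × S.edges l₂ l₃) ×
      (S.edges l₃ l₄ × S.edges l₄ l₁))).val.map fun x =>
    Link.quad x.1.1.1 x.1.2.1 x.2.1.1 x.2.2.1 (by rw [lab_across_of_edges, lab_of_edges])
      (by rw [lab_across_of_edges, lab_of_edges]) (by rw [lab_across_of_edges, lab_of_edges])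
      (by rw [lab_across_of_edges, lab_of_edges]) (by rwa [lab_of_edges, lab_of_edges])
      (by rwa [lab_of_edges, lab_of_edges])

lemma sum_edges_prod_across {Φ : W → W → ℤ} (l m m' : β × Bool) :
    ∑ x : S.edges m l, ∑ y : S.edges l m', Φ (S.across x.1) y.1 = S.pairs Φ l m m' := by
  rw [Finset.sum_coe_sort (S.edges m l) fun x => ∑ y : S.edges l m', Φ (S.across x) y.1,
    S.sum_edges_across m l fun x => ∑ y : S.edges l m', Φ x y.1]
  exact Finset.sum_congr rfl fun t _ => Finset.sum_coe_sort (S.edges l m') _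

lemma total_quads {Φ : W → W → ℤ} (l₁ l₂ l₃ l₄ : β × Bool) (h₁₃ : l₁ ≠ l₃) (h₂₄ : l₂ ≠ l₄) :
    total (S.quads l₁ l₂ l₃ l₄ h₁₃ h₂₄) Φ =
      S.mult l₂ l₃ * S.mult l₃ l₄ * S.pairs Φ l₁ l₄ l₂ +
      S.mult l₃ l₄ * S.mult l₄ l₁ * S.pairs Φ l₂ l₁ l₃ +
      S.mult l₄ l₁ * S.mult l₁ l₂ * S.pairs Φ l₃ l₂ l₄ +
      S.mult l₁ l₂ * S.mult l₂ l₃ * S.pairs Φ l₄ l₃ l₁ := by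
  rw [quads, total_map]
  simp only [Link.pairSum_quad, Finset.sum_add_distrib, Fintype.sum_prod_type]
  have h : ∀ l m, (Fintype.card (S.edges l m) : ℤ) = S.mult l m := fun l m => by
    simp [mult]
  simp only [Finset.sum_const, Finset.card_univ, nsmul_eq_mul, h]
  rw [← S.sum_edges_prod_across l₁, ← S.sum_edges_prod_across l₂, ← S.sum_edges_prod_across l₃,
    ← S.sum_edges_prod_across l₄]
  simp only [← Finset.mul_sum]
  rw [Finset.sum_comm (s := (Finset.univ : Finset (S.edges l₁ l₂)))
    (t := (Finset.univ : Finset (S.edges l₄ l₁)))]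
  ring

end Edges
end FlagSystem
/-! ### Gluing rows of letters -/

lemma letterInv_fst {β : Type*} (l : β × Bool) : (letterInv l).1 = l.1 := rfl

namespace FlagSystem

section Follows

variable {W β : Type} (S : FlagSystem W β)

/-- The flag `t` may follow the flag `t'` in a row of letters `b`: either it does so in a word, or
it starts a maximal block of letters `b`, the flag `t'` ends such a block, and the two corners
met there are joined to each other by an edge of the Whitehead graph from a letter `a^{±1}` to its
inverse. -/
def Follows (a b : β × Bool) (t' t : W) : Prop :=
  S.lab t' = b ∧ S.lab t = b ∧ (t = S.next t' ∨
    ((S.lab (S.across t)).1 = a.1 ∧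
      S.lab (S.across (S.along t')) = letterInv (S.lab (S.across t))))

variable {S}

lemma Follows.next_or {a b : β × Bool} {t' t : W} (h : S.Follows a b t' t) :
    (t = S.next t' ∧ S.lab (S.across t) = letterInv b ∧ S.lab (S.across (S.along t')) = b) ∨
    ((S.lab (S.across t)).1 = a.1 ∧
      S.lab (S.across (S.along t')) = letterInv (S.lab (S.across t))) := by
  obtain ⟨h1, h2, rfl | h3⟩ := h
  · refine Or.inl ⟨rfl, ?_, h2⟩
    rw [next, S.across_across, S.lab_along, h1]
  · exact Or.inr h3

end Follows

section Steps

variable {W β : Type} [Fintype W] [DecidableEq β] (S : FlagSystem W β)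

/-- For a flag `t` labelled by a letter `c = a^{±1}`, the sum of `Φ t h` over the edges `h` from
`c` to its inverse; zero for other flags. -/
def wing (Φ : W → W → ℤ) (a : β × Bool) (t : W) : ℤ :=
  if (S.lab t).1 = a.1 then ∑ h ∈ S.edges (S.lab t) (letterInv (S.lab t)), Φ t h else 0

variable {S}

lemma wing_of_lab_eq {Φ : W → W → ℤ} {a c : β × Bool} {t : W} (ht : S.lab t = c)
    (hc : c.1 = a.1) : S.wing Φ a t = ∑ h ∈ S.edges c (letterInv c), Φ t h := by
  rw [wing, ht, if_pos hc]

lemma wing_of_lab_ne {Φ : W → W → ℤ} {a : β × Bool} {t : W} (ht : (S.lab t).1 ≠ a.1) :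
    S.wing Φ a t = 0 := if_neg ht

lemma mult_letterInv_eq {a c : β × Bool} (hc : c.1 = a.1) :
    S.mult c (letterInv c) = S.mult a (letterInv a) := by
  rcases eq_or_eq_letterInv hc with rfl | rfl
  · rfl
  · rw [letterInv_letterInv, mult_comm]

variable (S)

/-- The family `𝓒` of links realizes the passage from two aligned letters `t'`, `u'` of two rows
to the next two aligned letters `t`, `u`. -/
def RealizesStep (a : β × Bool) (t' u' t u : W) (𝓒 : Multiset S.Link) : Prop :=
  ∀ Φ : W → W → ℤ, (∀ t t', Φ t t' = Φ t' t) → total 𝓒 Φ =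
    S.mult a (letterInv a) * (Φ t u + Φ (S.along t') (S.along u')) +
    (S.wing Φ a (S.across t) + S.wing Φ a (S.across u) +
      S.wing Φ a (S.across (S.along t')) + S.wing Φ a (S.across (S.along u')))

variable {S}

lemma RealizesStep.symm {a : β × Bool} {t' u' t u : W} {𝓒 : Multiset S.Link}
    (h : S.RealizesStep a t' u' t u 𝓒) : S.RealizesStep a u' t' u t 𝓒 := by
  intro Φ hΦ
  rw [h Φ hΦ, hΦ t u, hΦ (S.along t')]
  ring

variable {a b : β × Bool} {t' u' t u : W}

/-- At a place where a block of the first row ends and the second row goes on, each edge `g` from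
the letter `c` to its inverse completes the three given corners to a cycle of length four. -/
lemma exists_realizesStep_quad (hab : a.1 ≠ b.1) (ht' : S.lab t' = b) (ht : S.lab t = b)
    (hu' : S.lab u' = b) (hu : u = S.next u') (hub : S.lab u = b)
    (h1 : (S.lab (S.across t)).1 = a.1)
    (h2 : S.lab (S.across (S.along t')) = letterInv (S.lab (S.across t))) :
    ∃ 𝓒, S.RealizesStep a t' u' t u 𝓒 := by
  obtain ⟨c, hc⟩ : ∃ c, c = S.lab (S.across t) := ⟨_, rfl⟩
  rw [← hc] at h1 h2
  have hat : S.lab (S.along t') = letterInv b := by rw [S.lab_along, ht']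
  have hau : S.lab (S.along u') = letterInv b := by rw [S.lab_along, hu']
  have huu : S.lab (S.across (S.along u')) = b := by rw [← hub, hu, next]
  have hau2 : S.lab (S.across u) = letterInv b := by rw [hu, next, S.across_across, hau]
  let f : S.edges c (letterInv c) → S.Link := fun g =>
    Link.quad t g.1 (S.across (S.along t')) (S.along u')
      (by rw [← hc, lab_of_edges]) (by rw [lab_across_of_edges, h2])
      (by rw [S.across_across, hat, hau]) (by rw [huu, ht])
      (by
        rw [ht, h2]
        intro e
        apply hab
        rw [e, letterInv_fst, h1])
      (by
        rw [lab_of_edges, hau]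
        intro e
        apply hab
        rw [← h1, e, letterInv_fst])
  refine ⟨Finset.univ.val.map f, fun Φ hΦ => ?_⟩
  rw [total_map, ← mult_letterInv_eq h1, wing_of_lab_eq hc.symm h1,
    wing_of_lab_eq h2 (by rw [letterInv_fst, h1]),
    wing_of_lab_ne (t := S.across u) (by rw [hau2, letterInv_fst]; exact hab.symm),
    wing_of_lab_ne (t := S.across (S.along u')) (by rw [huu]; exact hab.symm), letterInv_letterInv]
  simp only [f, Link.pairSum_quad, Finset.sum_add_distrib]
  rw [Finset.sum_coe_sort (S.edges c (letterInv c)) fun g => Φ (S.across t) g,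
    Finset.sum_coe_sort (S.edges c (letterInv c)) fun g =>
      Φ (S.across g) (S.across (S.along t')),
    S.sum_edges_across c (letterInv c) fun g => Φ g (S.across (S.along t'))]
  simp only [Finset.sum_const, Finset.card_univ, Fintype.card_coe, nsmul_eq_mul,
    S.across_across]
  rw [hu, next, hΦ t, Finset.sum_congr rfl fun g _ => hΦ g (S.across (S.along t'))]
  simp only [mult]
  ring

/-- Two aligned letters of two rows can be followed by two others unless blocks of the same kind
start there in both rows. -/
theorem exists_realizesStep (hab : a.1 ≠ b.1) (ht : S.Follows a b t' t)
    (hu : S.Follows a b u' u)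
    (hne : (S.lab (S.across t)).1 = a.1 → S.lab (S.across u) ≠ S.lab (S.across t)) :
    ∃ 𝓒, S.RealizesStep a t' u' t u 𝓒 := by
  have hat : S.lab (S.along t') = letterInv b := by rw [S.lab_along, ht.1]
  have hau : S.lab (S.along u') = letterInv b := by rw [S.lab_along, hu.1]
  rcases ht.next_or with ⟨ht1, ht2, ht3⟩ | ⟨ht1, ht2⟩
  · rcases hu.next_or with ⟨hu1, hu2, hu3⟩ | ⟨hu1, hu2⟩
    · refine ⟨S.mult a (letterInv a) • {Link.bigon t (S.along u') (by rw [ht2, hau])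
        (by rw [hu3, ht.2.1])}, fun Φ hΦ => ?_⟩
      rw [total_nsmul,
        wing_of_lab_ne (t := S.across t) (by rw [ht2, letterInv_fst]; exact hab.symm),
        wing_of_lab_ne (t := S.across u) (by rw [hu2, letterInv_fst]; exact hab.symm),
        wing_of_lab_ne (t := S.across (S.along t')) (by rw [ht3]; exact hab.symm),
        wing_of_lab_ne (t := S.across (S.along u')) (by rw [hu3]; exact hab.symm)]
      simp only [total, Multiset.map_singleton, Multiset.sum_singleton, Link.pairSum_bigon]
      have e1 : S.across t = S.along t' := by rw [ht1, next, S.across_across]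
      have e2 : S.across (S.along u') = u := by rw [hu1, next]
      rw [e1, e2, hΦ u t]
      ring
    · obtain ⟨𝓒, h⟩ := exists_realizesStep_quad hab hu.1 hu.2.1 ht.1 ht1 ht.2.1 hu1 hu2
      exact ⟨𝓒, h.symm⟩
  · rcases hu.next_or with ⟨hu1, hu2, hu3⟩ | ⟨hu1, hu2⟩
    · exact exists_realizesStep_quad hab ht.1 ht.2.1 hu.1 hu1 hu.2.1 ht1 ht2
    · obtain ⟨c, hc⟩ : ∃ c, c = S.lab (S.across t) := ⟨_, rfl⟩
      have hcu : S.lab (S.across u) = letterInv c := by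
        rcases eq_or_eq_letterInv (hu1.trans ht1.symm) with h | h
        · exact absurd h (hne ht1)
        · rw [h, hc]
      rw [← hc] at ht1 ht2
      rw [hcu, letterInv_letterInv] at hu2
      let f : S.edges c (letterInv c) → S.Link := fun g =>
        Link.triangle t g.1 (S.across u) (by rw [← hc, lab_of_edges])
          (by rw [lab_across_of_edges, hcu]) (by rw [S.across_across, hu.2.1, ht.2.1])
      let f' : S.edges c (letterInv c) → S.Link := fun g =>
        Link.triangle (S.along t') (S.across g.1) (S.across (S.along u'))
          (by rw [ht2, lab_across_of_edges])
          (by rw [S.across_across, lab_of_edges, hu2]) (by rw [S.across_across, hau, hat])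
      refine ⟨Finset.univ.val.map f + Finset.univ.val.map f', fun Φ hΦ => ?_⟩
      have hc' : (letterInv c).1 = a.1 := by rw [letterInv_fst, ht1]
      rw [total_add, total_map, total_map, ← mult_letterInv_eq ht1, wing_of_lab_eq hc.symm ht1,
        wing_of_lab_eq hcu hc', wing_of_lab_eq ht2 hc', wing_of_lab_eq hu2 ht1,
        letterInv_letterInv]
      simp only [f, f', Link.pairSum_triangle, Finset.sum_add_distrib]
      rw [Finset.sum_coe_sort (S.edges c (letterInv c)) fun g => Φ (S.across t) g,
        Finset.sum_coe_sort (S.edges c (letterInv c)) fun g => Φ (S.across g) (S.across u),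
        S.sum_edges_across c (letterInv c) fun g => Φ g (S.across u),
        Finset.sum_coe_sort (S.edges c (letterInv c)) fun g =>
          Φ (S.across (S.along t')) (S.across g),
        S.sum_edges_across c (letterInv c) fun g => Φ (S.across (S.along t')) g]
      simp only [Finset.sum_const, Finset.card_univ, Fintype.card_coe, nsmul_eq_mul,
        S.across_across]
      rw [Finset.sum_coe_sort (S.edges c (letterInv c)) fun g => Φ g (S.across (S.along u'))]
      rw [Finset.sum_congr rfl fun g _ => hΦ g (S.across (S.along u')),
        Finset.sum_congr rfl fun g _ => hΦ g (S.across u), hΦ u t, hΦ (S.along u')]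
      simp only [mult]
      ring

/-- A finite family of steps which leads from a family of unordered pairs of aligned letters to
the same family is realized by links. On the whole, each occurrence of a letter `t` in a row
contributes the edges from `a^{±1}` to its inverse at both of its ends. -/
theorem exists_links_of_steps {J : Type*} (s : Finset J) (hab : a.1 ≠ b.1) (t' u' t u : J → W)
    (ht : ∀ j ∈ s, S.Follows a b (t' j) (t j)) (hu : ∀ j ∈ s, S.Follows a b (u' j) (u j))
    (hne : ∀ j ∈ s, (S.lab (S.across (t j))).1 = a.1 →
      S.lab (S.across (u j)) ≠ S.lab (S.across (t j)))
    (hbal : ∀ Φ : W → W → ℤ, (∀ t t', Φ t t' = Φ t' t) →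
      ∑ j ∈ s, Φ (t' j) (u' j) = ∑ j ∈ s, Φ (t j) (u j)) :
    ∃ 𝓒 : Multiset S.Link, ∀ Φ : W → W → ℤ, (∀ t t', Φ t t' = Φ t' t) →
      total 𝓒 Φ = S.mult a (letterInv a) * (∑ j ∈ s, Φ (t j) (u j) +
          ∑ j ∈ s, Φ (S.along (t j)) (S.along (u j))) +
        ∑ j ∈ s, ((S.wing Φ a (S.across (t j)) + S.wing Φ a (S.across (S.along (t j)))) +
          (S.wing Φ a (S.across (u j)) + S.wing Φ a (S.across (S.along (u j))))) := by
  classical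
  have h : ∀ j, ∃ 𝓒, j ∈ s → S.RealizesStep a (t' j) (u' j) (t j) (u j) 𝓒 := by
    intro j
    by_cases hj : j ∈ s
    · obtain ⟨𝓒, h⟩ := exists_realizesStep hab (ht j hj) (hu j hj) (hne j hj)
      exact ⟨𝓒, fun _ => h⟩
    · exact ⟨0, fun h => absurd h hj⟩
  choose 𝓒 h𝓒 using h
  refine ⟨∑ j ∈ s, 𝓒 j, fun Φ hΦ => ?_⟩
  rw [total_sum, Finset.sum_congr rfl fun j hj => h𝓒 j hj Φ hΦ]
  have h1 := hbal (fun t t' => Φ (S.along t) (S.along t')) fun _ _ => hΦ _ _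
  have h2 := hbal (fun t t' => S.wing Φ a (S.across (S.along t)) +
    S.wing Φ a (S.across (S.along t'))) fun _ _ => add_comm _ _
  simp only [Finset.sum_add_distrib, ← Finset.mul_sum] at h1 h2 ⊢
  rw [h1]
  linarith

end Steps
end FlagSystem
/-! ### Permutations of letters and brick patterns -/

/-- Two subsets of the same finite cardinality are in a bijection fixing their intersection. -/
lemma exists_equiv_subtype_fixing {T : Type*} [Fintype T] (p q : T → Prop)
    [DecidablePred p] [DecidablePred q]
    (h : (Finset.univ.filter p).card = (Finset.univ.filter q).card) :
    ∃ e : {t // p t} ≃ {t // q t}, ∀ t (hp : p t), q t → (e ⟨t, hp⟩ : T) = t := by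
  classical
  have h1 : Fintype.card {t // p t ∧ ¬ q t} = Fintype.card {t // q t ∧ ¬ p t} := by
    have := Finset.card_sdiff_comm h
    rw [Fintype.card_subtype, Fintype.card_subtype]
    convert this using 2 <;> ext t <;> simp
  let e := Fintype.equivOfCardEq h1
  let f : T → T := fun t =>
    if h : p t ∧ ¬ q t then e ⟨t, h⟩ else if h : q t ∧ ¬ p t then e.symm ⟨t, h⟩ else t
  have hf1 : ∀ t (h : p t ∧ ¬ q t), f t = e ⟨t, h⟩ := fun t h => by simp [f, h]
  have hf2 : ∀ t (h : q t ∧ ¬ p t), f t = e.symm ⟨t, h⟩ := fun t h => by simp [f, h]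
  have hf3 : ∀ t, ¬ (p t ∧ ¬ q t) → ¬ (q t ∧ ¬ p t) → f t = t := fun t h h' => by
    simp only [f, dif_neg h, dif_neg h']
  have hff : Function.Involutive f := by
    intro t
    by_cases h : p t ∧ ¬ q t
    · rw [hf1 t h, hf2 _ (e ⟨t, h⟩).2]
      simp
    · by_cases h' : q t ∧ ¬ p t
      · rw [hf2 t h', hf1 _ (e.symm ⟨t, h'⟩).2]
        simp
      · rw [hf3 t h h', hf3 t h h']
  refine ⟨(hff.toPerm f).subtypeEquiv fun t => ?_, fun t hp hq => ?_⟩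
  · change p t ↔ q (f t)
    by_cases h : p t ∧ ¬ q t
    · rw [hf1 t h]
      exact ⟨fun _ => (e ⟨t, h⟩).2.1, fun _ => h.1⟩
    · by_cases h' : q t ∧ ¬ p t
      · rw [hf2 t h']
        exact ⟨fun hp => absurd hp h'.2, fun hq => absurd hq (e.symm ⟨t, h'⟩).2.2⟩
      · rw [hf3 t h h']
        tauto
  · change f t = t
    exact hf3 t (fun h => h.2 hq) (fun h => h.2 hp)

section FirstReturn

variable {T L : Type*} [DecidableEq L] (c : Equiv.Perm T) (ε : T → L) (e : L)

/-- One or two steps of the permutation `c`: a second step is made after the elements on which `ε`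
takes the value `e`. -/
def skip (t : T) : T := if ε t = e then c (c t) else c t

/-- The element of the second row aligned with `t`: the element `r`, except that at the elements
on which `ε` takes the value `e` the successor of `t` is put there. -/
def partner (r t : T) : T := if ε t = e then c t else r

variable {c ε e} {σ : T → L}

lemma fst_skip_ne (hc : ∀ t, σ (c t) = ε t)
    (hfix : ∀ t, σ t = e → ε t = e → c t = t) {t : T} (ht : σ t ≠ e) : σ (skip c ε e t) ≠ e := by
  unfold skip
  split_ifs with h
  · intro h'
    rw [hc] at h'
    have h1 := hfix (c t) (by rw [hc, h]) h'
    rw [c.injective h1] at h'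
    have h2 : c t = t := c.injective h1
    rw [← h2, hc] at ht
    exact ht h
  · rwa [hc]

variable [Fintype T]

lemma sum_skip {M : Type*} [AddCommMonoid M] (hc : ∀ t, σ (c t) = ε t)
    (hfix : ∀ t, σ t = e → ε t = e → c t = t) (f : T → M) :
    ∑ t ∈ Finset.univ.filter (fun t => σ t ≠ e), f (skip c ε e t) =
      ∑ t ∈ Finset.univ.filter (fun t => σ t ≠ e), f t := by
  have hmaps : Set.MapsTo (skip c ε e) (Finset.univ.filter fun t => σ t ≠ e)
      (Finset.univ.filter fun t => σ t ≠ e) := by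
    intro t ht
    simp only [Finset.coe_filter, Finset.mem_univ, true_and, Set.mem_ofPred_eq] at ht ⊢
    exact fst_skip_ne hc hfix ht
  have hinj : Set.InjOn (skip c ε e) (Finset.univ.filter fun t => σ t ≠ e) := by
    intro t ht t' ht' h
    simp only [Finset.coe_filter, Finset.mem_univ, true_and, Set.mem_ofPred_eq] at ht ht'
    unfold skip at h
    split_ifs at h with h1 h2 h2
    · exact c.injective (c.injective h)
    · rw [← c.injective h, hc] at ht'
      exact absurd h1 ht'
    · rw [c.injective h, hc] at ht
      exact absurd h2 ht
    · exact c.injective h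
  exact Finset.sum_nbij _ hmaps hinj
    (Finset.surjOn_of_injOn_of_card_le _ hmaps hinj le_rfl) fun _ _ => rfl

/-- The number of occurrences of the elements in the pairs formed by elements and their partners:
each element which is not `e`-single occurs once for each `e`-single element `r`. -/
lemma sum_partner (hc : ∀ t, σ (c t) = ε t)
    (hfix : ∀ t, σ t = e → ε t = e → c t = t) (F : T → ℤ) :
    ∑ r ∈ Finset.univ.filter (fun t => σ t = e ∧ ε t = e),
      ∑ t ∈ Finset.univ.filter (fun t => σ t ≠ e), (F t + F (partner c ε e r t)) =
    ((Finset.univ.filter fun t => σ t = e ∧ ε t = e).card : ℤ) *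
        ∑ t ∈ Finset.univ.filter (fun t => ¬ (σ t = e ∧ ε t = e)), F t +
      ((Finset.univ.filter fun t => σ t ≠ e ∧ ε t ≠ e).card : ℤ) *
        ∑ t ∈ Finset.univ.filter (fun t => σ t = e ∧ ε t = e), F t := by
  have h1 : ∑ t ∈ Finset.univ.filter (fun t => σ t ≠ e ∧ ε t = e), F (c t) =
      ∑ t ∈ Finset.univ.filter (fun t => σ t = e ∧ ε t ≠ e), F t := by
    refine Finset.sum_nbij c ?_ c.injective.injOn ?_ fun _ _ => rfl
    · intro t ht
      simp only [Finset.mem_filter, Finset.mem_univ, true_and] at ht ⊢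
      refine ⟨by rw [hc, ht.2], fun h => ht.1 ?_⟩
      have h2 := c.injective (hfix (c t) (by rw [hc, ht.2]) h)
      rw [← h2, hc, ht.2]
    · intro t ht
      simp only [Finset.coe_filter, Finset.mem_univ, true_and, Set.mem_ofPred_eq] at ht
      refine ⟨c.symm t, ?_, c.apply_symm_apply t⟩
      have h2 : ε (c.symm t) = e := by rw [← hc, c.apply_symm_apply, ht.1]
      simp only [Finset.coe_filter, Finset.mem_univ, true_and, Set.mem_ofPred_eq]
      refine ⟨fun h => ht.2 ?_, h2⟩
      have h3 := hfix _ h h2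
      rw [c.apply_symm_apply] at h3
      rw [h3, h2]
  have h2 : ∀ r, ∑ t ∈ Finset.univ.filter (fun t => σ t ≠ e), (F t + F (partner c ε e r t)) =
      ∑ t ∈ Finset.univ.filter (fun t => ¬ (σ t = e ∧ ε t = e)), F t +
        ((Finset.univ.filter fun t => σ t ≠ e ∧ ε t ≠ e).card : ℤ) * F r := by
    intro r
    rw [Finset.sum_add_distrib,
      ← Finset.sum_filter_add_sum_filter_not (Finset.univ.filter fun t => σ t ≠ e)
        (fun t => ε t = e) fun t => F (partner c ε e r t), Finset.filter_filter,
      Finset.filter_filter]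
    have h3 : ∑ t ∈ Finset.univ.filter (fun t => σ t ≠ e ∧ ε t = e), F (partner c ε e r t) =
        ∑ t ∈ Finset.univ.filter (fun t => σ t ≠ e ∧ ε t = e), F (c t) :=
      Finset.sum_congr rfl fun t ht => by
        rw [partner, if_pos (Finset.mem_filter.1 ht).2.2]
    have h4 : ∑ t ∈ Finset.univ.filter (fun t => σ t ≠ e ∧ ¬ ε t = e), F (partner c ε e r t) =
        ∑ t ∈ Finset.univ.filter (fun t => σ t ≠ e ∧ ε t ≠ e), F r :=
      Finset.sum_congr rfl fun t ht => by
        rw [partner, if_neg (Finset.mem_filter.1 ht).2.2]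
    have h5 : ∑ t ∈ Finset.univ.filter (fun t => ¬ (σ t = e ∧ ε t = e)), F t =
        ∑ t ∈ Finset.univ.filter (fun t => σ t ≠ e), F t +
          ∑ t ∈ Finset.univ.filter (fun t => σ t = e ∧ ε t ≠ e), F t := by
      rw [← Finset.sum_filter_add_sum_filter_not
        (Finset.univ.filter fun t => ¬ (σ t = e ∧ ε t = e)) (fun t => σ t ≠ e) F,
        Finset.filter_filter, Finset.filter_filter]
      congr 2 <;> ext t <;> simp only [Finset.mem_filter, Finset.mem_univ, true_and] <;> tauto
    rw [h3, h4, h1, h5, Finset.sum_const, nsmul_eq_mul]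
    ring
  rw [Finset.sum_congr rfl fun r _ => h2 r, Finset.sum_add_distrib, Finset.sum_const,
    nsmul_eq_mul, ← Finset.mul_sum]

end FirstReturn

/-- Three families of brick patterns use the letters of three kinds (two kinds of single letters,
and the others) in proportions `(k₁, n₁, n₁)`, `(n₂, k₂, n₂)` and `(0, 0, 2)`. They can be combined
so as to use all letters equally. -/
lemma exists_balancing_multiplicities (n₁ n₂ k₁ k₂ : ℕ) (h₁ : n₁ ≤ k₁) (h₂ : n₂ ≤ k₂)
    (h₁₂ : n₂ ≤ k₁) (h₂₁ : n₁ ≤ k₂) :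
    ∃ α₁ α₂ γ N : ℕ, 0 < N ∧ (0 < n₁ → α₁ * k₁ + α₂ * n₂ = N) ∧
      (0 < n₂ → α₁ * n₁ + α₂ * k₂ = N) ∧ α₁ * n₁ + α₂ * n₂ + 2 * γ = N := by
  obtain ⟨d₁, rfl⟩ := Nat.exists_eq_add_of_le h₁
  obtain ⟨d₂, rfl⟩ := Nat.exists_eq_add_of_le h₂
  rcases Nat.eq_zero_or_pos (n₁ + n₂) with h0 | h0
  · have : n₁ = 0 := by omega
    have : n₂ = 0 := by omega
    subst n₁ n₂
    exact ⟨0, 0, 1, 2, by norm_num, by omega, by omega, by omega⟩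
  rcases Nat.eq_zero_or_pos (d₁ + d₂) with hd | hd
  · have : d₁ = 0 := by omega
    have : d₂ = 0 := by omega
    subst d₁ d₂
    exact ⟨1, 1, 0, n₁ + n₂, h0, by intro; ring, by intro; ring, by ring⟩
  · refine ⟨2 * d₂, 2 * d₁, d₁ * d₂, 2 * (d₂ * (n₁ + d₁) + d₁ * n₂), ?_, ?_, ?_, by ring⟩
    · have : 0 < d₂ * (n₁ + d₁) + d₁ * n₂ := by
        rcases Nat.eq_zero_or_pos d₁ with h | h
        · subst h
          have : 0 < d₂ * n₁ := Nat.mul_pos (by omega) (by omega)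
          simpa using this
        · rcases Nat.eq_zero_or_pos n₂ with h' | h'
          · have : 0 < d₂ := by omega
            positivity
          · positivity
      omega
    · intro; ring
    · intro; ring

/-! ### The links provided by brick patterns -/

namespace FlagSystem

section Ends

variable {W β : Type} {S : FlagSystem W β} {a b : β × Bool}

variable (S b) in
/-- The label of the corner at the beginning of a letter `b`. -/
def startLab (t : {t // S.lab t = b}) : β × Bool := S.lab (S.across t)

variable (S b) in
/-- The inverse of the label of the corner at the end of a letter `b`, that is, the label which
the corner at the beginning of the next letter of a row has to have. -/
def endLab (t : {t // S.lab t = b}) : β × Bool := letterInv (S.lab (S.across (S.along t)))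

lemma startLab_ne (t : {t // S.lab t = b}) : S.startLab b t ≠ b := fun h =>
  S.lab_across_ne t.1 (h.trans t.2.symm)

lemma endLab_ne (t : {t // S.lab t = b}) : S.endLab b t ≠ b := fun h => by
  have h' := congrArg letterInv h
  rw [endLab, letterInv_letterInv] at h'
  apply S.lab_across_ne (S.along t.1)
  rw [h', S.lab_along, t.2]

lemma follows_of_endLab_eq {e : β × Bool} (he : e.1 = a.1) {t u : {t // S.lab t = b}}
    (ht : S.endLab b t = e) (hu : S.startLab b u = e) : S.Follows a b t u := by
  refine ⟨t.2, u.2, Or.inr ⟨?_, ?_⟩⟩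
  · change (S.startLab b u).1 = a.1
    rw [hu, he]
  · change _ = letterInv (S.startLab b u)
    rw [hu, ← ht, endLab, letterInv_letterInv]

end Ends

section Bricks

variable {W β : Type} [Fintype W] [DecidableEq β] {S : FlagSystem W β} {a b : β × Bool}

lemma sum_filter_lab {M : Type*} [AddCommMonoid M] (hab : a.1 ≠ b.1)
    (hall : ∀ l : β × Bool, l.1 = a.1 ∨ l.1 = b.1) (f : W → M) :
    ∑ t ∈ Finset.univ.filter (fun t => S.lab t = b), f t =
      ∑ t ∈ S.edges b (letterInv b), f t + ∑ t ∈ S.edges b a, f t +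
        ∑ t ∈ S.edges b (letterInv a), f t := by
  classical
  rw [← Finset.sum_union, ← Finset.sum_union]
  · refine Finset.sum_congr ?_ fun _ _ => rfl
    ext t
    simp only [Finset.mem_filter, Finset.mem_univ, true_and, Finset.mem_union, mem_edges]
    constructor
    · intro ht
      rcases hall (S.lab (S.across t)) with h | h
      · rcases eq_or_eq_letterInv h with h | h
        · exact Or.inl (Or.inr ⟨ht, h⟩)
        · exact Or.inr ⟨ht, h⟩
      · rcases eq_or_eq_letterInv h with h | h
        · exact absurd (h.trans ht.symm) (S.lab_across_ne t)
        · exact Or.inl (Or.inl ⟨ht, h⟩)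
    · tauto
  · rw [Finset.disjoint_left]
    intro t ht ht'
    rw [mem_edges] at ht'
    rw [Finset.mem_union, mem_edges, mem_edges] at ht
    rcases ht with ht | ht
    · have h := congrArg Prod.fst (ht.2.symm.trans ht'.2)
      exact hab.symm h
    · exact letterInv_ne a (ht'.2.symm.trans ht.2)
  · rw [Finset.disjoint_left]
    intro t ht ht'
    rw [mem_edges] at ht ht'
    have h := congrArg Prod.fst (ht.2.symm.trans ht'.2)
    exact hab.symm h

lemma card_filter_lab (hab : a.1 ≠ b.1) (hall : ∀ l : β × Bool, l.1 = a.1 ∨ l.1 = b.1) :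
    (Finset.univ.filter fun t => S.lab t = b).card =
      S.mult b (letterInv b) + S.mult b a + S.mult b (letterInv a) := by
  have h := sum_filter_lab (S := S) hab hall fun _ => 1
  simp only [Finset.sum_const, smul_eq_mul, mul_one] at h
  exact h

lemma sum_filter_lab_along {M : Type*} [AddCommMonoid M] (l : β × Bool) (f : W → M) :
    ∑ t ∈ Finset.univ.filter (fun t => S.lab t = l), f (S.along t) =
      ∑ t ∈ Finset.univ.filter (fun t => S.lab t = letterInv l), f t := by
  refine Finset.sum_nbij' S.along S.along ?_ ?_ (fun t _ => S.along_along t)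
    (fun t _ => S.along_along t) fun _ _ => rfl
  · intro t ht
    simp only [Finset.mem_filter, Finset.mem_univ, true_and] at ht ⊢
    rw [S.lab_along, ht]
  · intro t ht
    simp only [Finset.mem_filter, Finset.mem_univ, true_and] at ht ⊢
    rw [S.lab_along, ht, letterInv_letterInv]

lemma card_filter_lab_letterInv (l : β × Bool) :
    (Finset.univ.filter fun t => S.lab t = l).card =
      (Finset.univ.filter fun t => S.lab t = letterInv l).card := by
  have h := sum_filter_lab_along (S := S) l fun _ => 1
  simp only [Finset.sum_const, smul_eq_mul, mul_one] at h
  exact h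

variable (S) in
/-- The sum of the two wings at the corners at the two ends of the side of `t`. -/
def wings (Φ : W → W → ℤ) (a : β × Bool) (t : W) : ℤ :=
  S.wing Φ a (S.across t) + S.wing Φ a (S.across (S.along t))

lemma sum_wing_across {Φ : W → W → ℤ} (hab : a.1 ≠ b.1)
    (hall : ∀ l : β × Bool, l.1 = a.1 ∨ l.1 = b.1) :
    ∑ t ∈ Finset.univ.filter (fun t => S.lab t = b), S.wing Φ a (S.across t) =
      S.pairs Φ a b (letterInv a) + S.pairs Φ (letterInv a) b a := by
  rw [sum_filter_lab hab hall, S.sum_edges_across, S.sum_edges_across, S.sum_edges_across,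
    Finset.sum_eq_zero, zero_add]
  · congr 1
    · refine Finset.sum_congr rfl fun t ht => ?_
      rw [wing_of_lab_eq (mem_edges.1 ht).1 rfl]
    · refine Finset.sum_congr rfl fun t ht => ?_
      rw [wing_of_lab_eq (mem_edges.1 ht).1 (letterInv_fst a), letterInv_letterInv]
  · intro t ht
    rw [wing_of_lab_ne]
    rw [(mem_edges.1 ht).1]
    exact hab.symm

lemma sum_wings {Φ : W → W → ℤ} (hab : a.1 ≠ b.1)
    (hall : ∀ l : β × Bool, l.1 = a.1 ∨ l.1 = b.1) :
    ∑ t : {t // S.lab t = b}, S.wings Φ a t =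
      S.pairs Φ a b (letterInv a) + S.pairs Φ (letterInv a) b a +
        (S.pairs Φ a (letterInv b) (letterInv a) + S.pairs Φ (letterInv a) (letterInv b) a) := by
  rw [← Finset.sum_subtype (Finset.univ.filter fun t => S.lab t = b) (by simp)]
  unfold wings
  rw [Finset.sum_add_distrib, sum_wing_across hab hall,
    sum_filter_lab_along b fun t => S.wing Φ a (S.across t),
    sum_wing_across (b := letterInv b) hab hall]

lemma card_startLab_eq (l : β × Bool) :
    (Finset.univ.filter fun t : {t // S.lab t = b} => S.startLab b t = l).card = S.mult b l := by
  unfold mult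
  refine Finset.card_bij (fun t _ => t.1) ?_ (fun _ _ _ _ h => Subtype.ext h) ?_
  · intro t ht
    exact mem_edges.2 ⟨t.2, (Finset.mem_filter.1 ht).2⟩
  · intro t ht
    rw [mem_edges] at ht
    exact ⟨⟨t, ht.1⟩, Finset.mem_filter.2 ⟨Finset.mem_univ _, ht.2⟩, rfl⟩

lemma card_endLab_eq (l : β × Bool) :
    (Finset.univ.filter fun t : {t // S.lab t = b} => S.endLab b t = l).card =
      S.mult (letterInv b) (letterInv l) := by
  unfold mult
  refine Finset.card_bij (fun t _ => S.along t.1) ?_ ?_ ?_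
  · intro t ht
    refine mem_edges.2 ⟨by rw [S.lab_along, t.2], ?_⟩
    rw [← (Finset.mem_filter.1 ht).2, endLab, letterInv_letterInv]
  · intro t _ t' _ h
    apply Subtype.ext
    rw [← S.along_along t, h, S.along_along]
  · intro t ht
    rw [mem_edges] at ht
    refine ⟨⟨S.along t, by rw [S.lab_along, ht.1, letterInv_letterInv]⟩, ?_, S.along_along t⟩
    refine Finset.mem_filter.2 ⟨Finset.mem_univ _, ?_⟩
    rw [endLab, S.along_along, ht.2, letterInv_letterInv]

/-- The blocks of letters `b` can be closed up to cyclic rows, those consisting of a single letter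
with equal labels at both ends being closed up by themselves. -/
lemma exists_perm_follows (hab : a.1 ≠ b.1) (hall : ∀ l : β × Bool, l.1 = a.1 ∨ l.1 = b.1)
    (h₁ : S.mult b a = S.mult (letterInv b) (letterInv a))
    (h₂ : S.mult b (letterInv a) = S.mult (letterInv b) a) :
    ∃ c : Equiv.Perm {t // S.lab t = b}, (∀ t, S.startLab b (c t) = S.endLab b t) ∧
      (∀ t : {t // S.lab t = b}, S.Follows a b t (c t)) ∧
      ∀ e : β × Bool, e.1 = a.1 → ∀ t, S.startLab b t = e → S.endLab b t = e → c t = t := by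
  classical
  have hcard : ∀ l, (Finset.univ.filter fun t => S.endLab b t = l).card =
      (Finset.univ.filter fun t => S.startLab b t = l).card := by
    intro l
    rw [card_startLab_eq, card_endLab_eq]
    rcases hall l with h | h
    · rcases eq_or_eq_letterInv h with rfl | rfl
      · exact h₁.symm
      · rw [letterInv_letterInv, h₂]
    · rcases eq_or_eq_letterInv h with rfl | rfl
      · rw [← card_endLab_eq, ← card_startLab_eq, Finset.filter_false_of_mem,
          Finset.filter_false_of_mem]
        · exact fun t _ => startLab_ne t
        · exact fun t _ => endLab_ne t
      · rw [letterInv_letterInv, mult_comm]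
  have key : ∀ l, ∃ e : {t // S.endLab b t = l} ≃ {t // S.startLab b t = l},
      (l = letterInv b → ∀ t, (e t).1.1 = S.next t.1.1) ∧
      (l ≠ letterInv b → ∀ t (h : S.endLab b t = l), S.startLab b t = l → (e ⟨t, h⟩).1 = t) := by
    intro l
    by_cases hl : l = letterInv b
    · subst hl
      have hlab : ∀ t : {t // S.lab t = b}, S.endLab b t = letterInv b →
          S.lab (S.next t.1) = b := by
        intro t ht
        rw [next, ← letterInv_letterInv (S.lab _)]
        change letterInv (S.endLab b t) = b
        rw [ht, letterInv_letterInv]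
      let f : {t // S.endLab b t = letterInv b} → {t // S.startLab b t = letterInv b} := fun t =>
        ⟨⟨S.next t.1, hlab t.1 t.2⟩, by
          change S.lab (S.across (S.across (S.along t.1.1))) = letterInv b
          rw [S.across_across, S.lab_along, t.1.2]⟩
      have hf : Function.Bijective f := by
        rw [Fintype.bijective_iff_injective_and_card, Fintype.card_subtype, Fintype.card_subtype]
        refine ⟨fun t t' h => ?_, hcard _⟩
        have h' : S.next t.1 = S.next t'.1 := congrArg (fun x => x.1.1) h
        apply Subtype.ext
        apply Subtype.ext
        rw [← S.along_along t.1.1, ← S.across_across (S.along t.1.1)]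
        change S.across (S.along t.1.1) = S.across (S.along t'.1.1) at h'
        rw [h', S.across_across, S.along_along]
      exact ⟨Equiv.ofBijective f hf, fun _ t => rfl, fun h => absurd rfl h⟩
    · obtain ⟨e, he⟩ := exists_equiv_subtype_fixing _ _ (hcard l)
      exact ⟨e, fun h => absurd h hl, fun _ => he⟩
  choose e he₁ he₂ using key
  let c : Equiv.Perm {t // S.lab t = b} := Equiv.ofFiberEquiv e
  have hcv : ∀ t l (h : S.endLab b t = l), c t = (e l ⟨t, h⟩).1 := by
    rintro t _ rfl
    rfl
  have hc : ∀ t, S.startLab b (c t) = S.endLab b t := fun t => by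
    rw [hcv t _ rfl]
    exact (e _ _).2
  refine ⟨c, hc, fun t => ⟨t.2, (c t).2, ?_⟩, fun l hl t hs ht => ?_⟩
  · by_cases hB : S.endLab b t = letterInv b
    · left
      rw [hcv t _ hB]
      exact he₁ _ rfl _
    · right
      have h1 : S.lab (S.across (c t)) = S.endLab b t := hc t
      rw [h1]
      refine ⟨?_, by rw [endLab, letterInv_letterInv]⟩
      rcases hall (S.endLab b t) with h | h
      · exact h
      · rcases eq_or_eq_letterInv h with h | h
        · exact absurd h (endLab_ne t)
        · exact absurd h hB
  · rw [hcv t _ ht]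
    refine he₂ _ (fun h => ?_) t ht hs
    rw [h, letterInv_fst] at hl
    exact hab.symm hl

variable {c : Equiv.Perm {t // S.lab t = b}}

/-- A single letter `r` beginning and ending with the label `e` is repeated in one row, while the
other row runs through the letters `t` which do not begin with the label `e`. After a letter ending
with the label `e`, where the next letter is not allowed, the rows exchange their roles. -/
lemma exists_links_of_single (hab : a.1 ≠ b.1) {e : β × Bool} (he : e.1 = a.1)
    (hc : ∀ t, S.startLab b (c t) = S.endLab b t)
    (hf : ∀ t : {t // S.lab t = b}, S.Follows a b t (c t))
    (hfix : ∀ t, S.startLab b t = e → S.endLab b t = e → c t = t) :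
    ∃ (𝓒 : Multiset S.Link) (Ψ : (W → W → ℤ) → ℤ),
      ∀ Φ : W → W → ℤ, (∀ t t', Φ t t' = Φ t' t) →
        total 𝓒 Φ = S.mult a (letterInv a) *
          (Ψ Φ + Ψ fun t t' => Φ (S.along t) (S.along t')) +
        (((Finset.univ.filter fun t => S.startLab b t = e ∧ S.endLab b t = e).card : ℤ) *
          ∑ t ∈ Finset.univ.filter (fun t => ¬ (S.startLab b t = e ∧ S.endLab b t = e)),
            S.wings Φ a t +
        ((Finset.univ.filter fun t => S.startLab b t ≠ e ∧ S.endLab b t ≠ e).card : ℤ) *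
          ∑ t ∈ Finset.univ.filter (fun t => S.startLab b t = e ∧ S.endLab b t = e),
            S.wings Φ a t) := by
  let s := (Finset.univ.filter fun t => S.startLab b t = e ∧ S.endLab b t = e) ×ˢ
    (Finset.univ.filter fun t => S.startLab b t ≠ e)
  let ε := S.endLab b
  let t₀ : {t // S.lab t = b} × {t // S.lab t = b} → {t // S.lab t = b} := fun j =>
    if ε j.2 = e then partner c ε e j.1 (skip c ε e j.2) else skip c ε e j.2
  let u₀ : {t // S.lab t = b} × {t // S.lab t = b} → {t // S.lab t = b} := fun j =>
    if ε j.2 = e then skip c ε e j.2 else partner c ε e j.1 (skip c ε e j.2)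
  have hsymm : ∀ Φ : W → W → ℤ, (∀ t t', Φ t t' = Φ t' t) → ∀ j, Φ (t₀ j) (u₀ j) =
      Φ (skip c ε e j.2).1 (partner c ε e j.1 (skip c ε e j.2)).1 := by
    intro Φ hΦ j
    simp only [t₀, u₀]
    split_ifs
    · exact hΦ _ _
    · rfl
  have hsum : ∀ Φ : W → W → ℤ, (∀ t t', Φ t t' = Φ t' t) →
      ∑ j ∈ s, Φ j.2.1 (partner c ε e j.1 j.2).1 = ∑ j ∈ s, Φ (t₀ j) (u₀ j) := by
    intro Φ hΦ
    rw [Finset.sum_congr rfl fun j _ => hsymm Φ hΦ j, Finset.sum_product, Finset.sum_product]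
    refine Finset.sum_congr rfl fun r _ => ?_
    exact (sum_skip hc hfix fun t => Φ t.1 (partner c ε e r t).1).symm
  have hpart : ∀ (j : {t // S.lab t = b} × {t // S.lab t = b}) (t : {t // S.lab t = b}), j ∈ s →
      S.startLab b (partner c ε e j.1 t) = e := by
    intro j t hj
    unfold partner
    split_ifs with h
    · rw [hc]
      exact h
    · exact (Finset.mem_filter.1 (Finset.mem_product.1 hj).1).2.1
  have hstart : ∀ j ∈ s, S.startLab b (skip c ε e j.2) ≠ e := fun j hj =>
    fst_skip_ne hc hfix (Finset.mem_filter.1 (Finset.mem_product.1 hj).2).2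
  obtain ⟨𝓒, h𝓒⟩ := exists_links_of_steps (S := S) s hab (fun j => j.2.1)
    (fun j => (partner c ε e j.1 j.2).1) (fun j => (t₀ j).1) (fun j => (u₀ j).1)
    (by
      intro j hj
      by_cases h : ε j.2 = e
      · simp only [t₀, if_pos h]
        exact follows_of_endLab_eq he h (hpart j _ hj)
      · simp only [t₀, if_neg h, skip]
        exact hf _)
    (by
      intro j hj
      by_cases h : ε j.2 = e
      · simp only [u₀, if_pos h, skip, partner]
        exact hf _
      · simp only [u₀, if_neg h]
        refine follows_of_endLab_eq he ?_ (hpart j _ hj)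
        rw [partner, if_neg h]
        exact (Finset.mem_filter.1 (Finset.mem_product.1 hj).1).2.2)
    (by
      intro j hj _ h
      have h' : S.startLab b (u₀ j) = S.startLab b (t₀ j) := h
      by_cases h1 : ε j.2 = e
      · simp only [t₀, u₀, if_pos h1] at h'
        rw [hpart j _ hj] at h'
        exact hstart j hj h'
      · simp only [t₀, u₀, if_neg h1] at h'
        rw [hpart j _ hj] at h'
        exact hstart j hj h'.symm)
    hsum
  refine ⟨𝓒, fun Φ => ∑ j ∈ s, Φ (t₀ j) (u₀ j), fun Φ hΦ => ?_⟩
  rw [h𝓒 Φ hΦ]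
  congr 1
  have h1 := hsum (fun t t' => S.wings Φ a t + S.wings Φ a t') fun _ _ => add_comm _ _
  rw [Finset.sum_product] at h1
  exact h1.symm.trans (sum_partner hc hfix fun t => S.wings Φ a t)

/-- Each row which contains no single letters of the two kinds is aligned with its own translate by
one letter. -/
lemma exists_links_of_translate (hab : a.1 ≠ b.1)
    (hc : ∀ t, S.startLab b (c t) = S.endLab b t)
    (hf : ∀ t : {t // S.lab t = b}, S.Follows a b t (c t))
    (hfix : ∀ e : β × Bool, e.1 = a.1 →
      ∀ t, S.startLab b t = e → S.endLab b t = e → c t = t) :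
    ∃ (𝓒 : Multiset S.Link) (Ψ : (W → W → ℤ) → ℤ),
      ∀ Φ : W → W → ℤ, (∀ t t', Φ t t' = Φ t' t) →
        total 𝓒 Φ = S.mult a (letterInv a) *
          (Ψ Φ + Ψ fun t t' => Φ (S.along t) (S.along t')) +
        2 * ∑ t ∈ Finset.univ.filter (fun t => ¬ (S.startLab b t = a ∧ S.endLab b t = a) ∧
          ¬ (S.startLab b t = letterInv a ∧ S.endLab b t = letterInv a)), S.wings Φ a t := by
  let s := Finset.univ.filter fun t => ¬ (S.startLab b t = a ∧ S.endLab b t = a) ∧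
    ¬ (S.startLab b t = letterInv a ∧ S.endLab b t = letterInv a)
  have hsing : ∀ e : β × Bool, e.1 = a.1 → ∀ t, ¬ (S.startLab b t = e ∧ S.endLab b t = e) →
      ¬ (S.startLab b (c t) = e ∧ S.endLab b (c t) = e) := by
    rintro e he t ht ⟨h1, h2⟩
    have h3 := c.injective (hfix e he _ h1 h2)
    rw [h3] at h1 h2
    exact ht ⟨h1, h2⟩
  have hmaps : Set.MapsTo c s s := by
    intro t ht
    simp only [s, Finset.coe_filter, Finset.mem_univ, true_and, Set.mem_ofPred_eq] at ht ⊢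
    exact ⟨hsing a rfl t ht.1, hsing (letterInv a) rfl t ht.2⟩
  have hsum : ∀ f : {t // S.lab t = b} → ℤ, ∑ t ∈ s, f (c t) = ∑ t ∈ s, f t := fun f =>
    Finset.sum_nbij _ hmaps c.injective.injOn
      (Finset.surjOn_of_injOn_of_card_le _ hmaps c.injective.injOn le_rfl) fun _ _ => rfl
  obtain ⟨𝓒, h𝓒⟩ := exists_links_of_steps (S := S) s hab (fun t => t.1) (fun t => (c t).1)
    (fun t => (c t).1) (fun t => (c (c t)).1) (fun t _ => hf t) (fun t _ => hf (c t))
    (by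
      intro t ht h1 h2
      have h3 : S.startLab b (c (c t)) = S.startLab b (c t) := h2
      rw [hc (c t)] at h3
      have h4 := hmaps ht
      simp only [s, Finset.coe_filter, Finset.mem_univ, true_and, Set.mem_ofPred_eq] at h4
      rcases eq_or_eq_letterInv h1 with h | h
      · exact h4.1 ⟨h, h3.trans h⟩
      · exact h4.2 ⟨h, h3.trans h⟩)
    (fun Φ _ => (hsum fun t => Φ t (c t)).symm)
  refine ⟨𝓒, fun Φ => ∑ t ∈ s, Φ (c t) (c (c t)), fun Φ hΦ => ?_⟩
  rw [h𝓒 Φ hΦ]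
  congr 1
  rw [Finset.sum_add_distrib]
  have h1 := hsum fun t => S.wings Φ a t
  have h2 := hsum fun t => S.wings Φ a (c t)
  unfold wings at *
  rw [h2, h1]
  ring

end Bricks
end FlagSystem
namespace FlagSystem

section BrickCounts

variable {W β : Type} [Fintype W] [DecidableEq β] {S : FlagSystem W β} {a b : β × Bool}

/-- Letters `b` beginning and ending with the label `a` do not outnumber those for which neither
label is `a`; this is what the Whitehead inequality says about the brick patterns. -/
lemma card_single_le (hab : a.1 ≠ b.1) (hall : ∀ l : β × Bool, l.1 = a.1 ∨ l.1 = b.1)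
    (h : S.mult b a = S.mult (letterInv b) (letterInv a))
    (hle : S.mult b a ≤ S.mult b (letterInv b) + S.mult b (letterInv a)) :
    (Finset.univ.filter fun t => S.startLab b t = a ∧ S.endLab b t = a).card ≤
      (Finset.univ.filter fun t => S.startLab b t ≠ a ∧ S.endLab b t ≠ a).card := by
  classical
  have h1 := Finset.card_union_add_card_inter
    (Finset.univ.filter fun t => S.startLab b t = a) (Finset.univ.filter fun t => S.endLab b t = a)
  rw [card_startLab_eq, card_endLab_eq, ← h, ← Finset.filter_or, ← Finset.filter_and] at h1
  have h2 := Finset.card_filter_add_card_filter_not (s := Finset.univ)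
    fun t => S.startLab b t = a ∨ S.endLab b t = a
  have h3 := card_filter_lab (S := S) hab hall
  rw [← Fintype.card_subtype, ← Finset.card_univ] at h3
  have h4 : (Finset.univ.filter fun t => ¬ (S.startLab b t = a ∨ S.endLab b t = a)) =
      Finset.univ.filter fun t => S.startLab b t ≠ a ∧ S.endLab b t ≠ a :=
    Finset.filter_congr fun t _ => not_or
  rw [h4] at h2
  omega

/-- The brick patterns can be combined so that all letters `b` are used equally often. -/
theorem exists_links_of_bricks (hab : a.1 ≠ b.1) (hall : ∀ l : β × Bool, l.1 = a.1 ∨ l.1 = b.1)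
    (h₁ : S.mult b a = S.mult (letterInv b) (letterInv a))
    (h₂ : S.mult b (letterInv a) = S.mult (letterInv b) a)
    (hle₁ : S.mult b a ≤ S.mult b (letterInv b) + S.mult b (letterInv a))
    (hle₂ : S.mult b (letterInv a) ≤ S.mult b (letterInv b) + S.mult b a) :
    ∃ (N : ℕ) (𝓑 : Multiset S.Link) (Ψ : (W → W → ℤ) → ℤ), 0 < N ∧
      ∀ Φ : W → W → ℤ, (∀ t t', Φ t t' = Φ t' t) →
        total 𝓑 Φ = S.mult a (letterInv a) *
          (Ψ Φ + Ψ fun t t' => Φ (S.along t) (S.along t')) +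
        N * (S.pairs Φ a b (letterInv a) + S.pairs Φ (letterInv a) b a +
          (S.pairs Φ a (letterInv b) (letterInv a) +
            S.pairs Φ (letterInv a) (letterInv b) a)) := by
  classical
  obtain ⟨c, hc, hf, hfix⟩ := exists_perm_follows hab hall h₁ h₂
  obtain ⟨𝓒₁, Ψ₁, hΨ₁⟩ := exists_links_of_single hab rfl hc hf (hfix a rfl)
  obtain ⟨𝓒₂, Ψ₂, hΨ₂⟩ :=
    exists_links_of_single hab (letterInv_fst a) hc hf (hfix (letterInv a) (letterInv_fst a))
  obtain ⟨𝓒₃, Ψ₃, hΨ₃⟩ := exists_links_of_translate hab hc hf hfix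
  have hle₁' := card_single_le hab hall h₁ hle₁
  have hle₂' := card_single_le (S := S) (a := letterInv a) (b := b) hab hall
    (by rw [letterInv_letterInv, h₂]) (by rw [letterInv_letterInv]; exact hle₂)
  have hA : a ≠ letterInv a := (letterInv_ne a).symm
  obtain ⟨α₁, α₂, γ, N, hN, e₁, e₂, e₃⟩ := exists_balancing_multiplicities _ _ _ _ hle₁' hle₂'
    (Finset.card_le_card fun t ht => by
      simp only [Finset.mem_filter, Finset.mem_univ, true_and] at ht ⊢
      rw [ht.1, ht.2]
      exact ⟨hA.symm, hA.symm⟩)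
    (Finset.card_le_card fun t ht => by
      simp only [Finset.mem_filter, Finset.mem_univ, true_and] at ht ⊢
      rw [ht.1, ht.2]
      exact ⟨hA, hA⟩)
  refine ⟨N, α₁ • 𝓒₁ + α₂ • 𝓒₂ + γ • 𝓒₃, fun Φ => α₁ * Ψ₁ Φ + α₂ * Ψ₂ Φ + γ * Ψ₃ Φ, hN,
    fun Φ hΦ => ?_⟩
  rw [total_add, total_add, total_nsmul, total_nsmul, total_nsmul, hΨ₁ Φ hΦ, hΨ₂ Φ hΦ, hΨ₃ Φ hΦ,
    ← sum_wings hab hall]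
  generalize hn₁ : (Finset.univ.filter fun t => S.startLab b t = a ∧ S.endLab b t = a).card = n₁
    at *
  generalize hn₂ : (Finset.univ.filter fun t => S.startLab b t = letterInv a ∧
    S.endLab b t = letterInv a).card = n₂ at *
  generalize (Finset.univ.filter fun t => S.startLab b t ≠ a ∧ S.endLab b t ≠ a).card = k₁ at *
  generalize (Finset.univ.filter fun t => S.startLab b t ≠ letterInv a ∧
    S.endLab b t ≠ letterInv a).card = k₂ at *
  have s₁ : ∑ t ∈ Finset.univ.filter (fun t => ¬ (S.startLab b t = a ∧ S.endLab b t = a)),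
      S.wings Φ a t =
      ∑ t ∈ Finset.univ.filter (fun t => S.startLab b t = letterInv a ∧
        S.endLab b t = letterInv a), S.wings Φ a t +
      ∑ t ∈ Finset.univ.filter (fun t => ¬ (S.startLab b t = a ∧ S.endLab b t = a) ∧
        ¬ (S.startLab b t = letterInv a ∧ S.endLab b t = letterInv a)), S.wings Φ a t := by
    rw [← Finset.sum_filter_add_sum_filter_not
      (Finset.univ.filter fun t => ¬ (S.startLab b t = a ∧ S.endLab b t = a))
      (fun t => S.startLab b t = letterInv a ∧ S.endLab b t = letterInv a),
      Finset.filter_filter, Finset.filter_filter]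
    congr 2
    ext t
    simp only [Finset.mem_filter, Finset.mem_univ, true_and, and_iff_right_iff_imp]
    rintro ⟨h, -⟩ ⟨h', -⟩
    exact hA (h'.symm.trans h)
  have s₂ : ∑ t ∈ Finset.univ.filter (fun t => ¬ (S.startLab b t = letterInv a ∧
        S.endLab b t = letterInv a)), S.wings Φ a t =
      ∑ t ∈ Finset.univ.filter (fun t => S.startLab b t = a ∧ S.endLab b t = a),
        S.wings Φ a t +
      ∑ t ∈ Finset.univ.filter (fun t => ¬ (S.startLab b t = a ∧ S.endLab b t = a) ∧
        ¬ (S.startLab b t = letterInv a ∧ S.endLab b t = letterInv a)), S.wings Φ a t := by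
    rw [← Finset.sum_filter_add_sum_filter_not
      (Finset.univ.filter fun t => ¬ (S.startLab b t = letterInv a ∧ S.endLab b t = letterInv a))
      (fun t => S.startLab b t = a ∧ S.endLab b t = a),
      Finset.filter_filter, Finset.filter_filter]
    congr 2
    · ext t
      simp only [Finset.mem_filter, Finset.mem_univ, true_and, and_iff_right_iff_imp]
      rintro ⟨h, -⟩ ⟨h', -⟩
      exact hA (h.symm.trans h')
    · ext t
      simp only [Finset.mem_filter, Finset.mem_univ, true_and]
      tauto
  have s₃ := Finset.sum_filter_add_sum_filter_not Finset.univ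
    (fun t => S.startLab b t = a ∧ S.endLab b t = a) fun t => S.wings Φ a t
  rw [s₁] at s₃
  rw [s₁, s₂, ← s₃]
  have z₁ : n₁ = 0 → ∑ t ∈ Finset.univ.filter (fun t => S.startLab b t = a ∧ S.endLab b t = a),
      S.wings Φ a t = 0 := fun h => by
    rw [Finset.card_eq_zero.1 (hn₁.trans h), Finset.sum_empty]
  have z₂ : n₂ = 0 → ∑ t ∈ Finset.univ.filter (fun t => S.startLab b t = letterInv a ∧
      S.endLab b t = letterInv a), S.wings Φ a t = 0 := fun h => by
    rw [Finset.card_eq_zero.1 (hn₂.trans h), Finset.sum_empty]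
  generalize ∑ t ∈ Finset.univ.filter (fun t => S.startLab b t = a ∧ S.endLab b t = a),
    S.wings Φ a t = X at *
  generalize ∑ t ∈ Finset.univ.filter (fun t => S.startLab b t = letterInv a ∧
    S.endLab b t = letterInv a), S.wings Φ a t = Y at *
  generalize ∑ t ∈ Finset.univ.filter (fun t => ¬ (S.startLab b t = a ∧ S.endLab b t = a) ∧
    ¬ (S.startLab b t = letterInv a ∧ S.endLab b t = letterInv a)), S.wings Φ a t = Z at *
  have f₁ : ((α₁ * k₁ + α₂ * n₂ : ℕ) : ℤ) * X = N * X := by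
    rcases Nat.eq_zero_or_pos n₁ with h | h
    · rw [z₁ h, mul_zero, mul_zero]
    · rw [e₁ h]
  have f₂ : ((α₁ * n₁ + α₂ * k₂ : ℕ) : ℤ) * Y = N * Y := by
    rcases Nat.eq_zero_or_pos n₂ with h | h
    · rw [z₂ h, mul_zero, mul_zero]
    · rw [e₂ h]
  have f₃ : ((α₁ * n₁ + α₂ * n₂ + 2 * γ : ℕ) : ℤ) * Z = N * Z := by rw [e₃]
  push_cast at f₁ f₂ f₃
  linear_combination f₁ + f₂ + f₃

end BrickCounts
end FlagSystem
/-! ### A balanced family of links -/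

namespace FlagSystem

section Balance

variable {W β : Type} [Fintype W] [DecidableEq β] {S : FlagSystem W β} {a b : β × Bool}

lemma exists_mem_quads {l₁ l₂ l₃ l₄ : β × Bool} (h₁₃ : l₁ ≠ l₃) (h₂₄ : l₂ ≠ l₄)
    (h₁ : 0 < S.mult l₁ l₂) (h₂ : 0 < S.mult l₂ l₃) (h₃ : 0 < S.mult l₃ l₄)
    (h₄ : 0 < S.mult l₄ l₁) : ∃ C ∈ S.quads l₁ l₂ l₃ l₄ h₁₃ h₂₄, 3 ≤ C.n := by
  obtain ⟨t₁, h₁⟩ := Finset.card_pos.1 h₁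
  obtain ⟨t₂, h₂⟩ := Finset.card_pos.1 h₂
  obtain ⟨t₃, h₃⟩ := Finset.card_pos.1 h₃
  obtain ⟨t₄, h₄⟩ := Finset.card_pos.1 h₄
  exact ⟨_, Multiset.mem_map_of_mem _
    (Finset.mem_univ ((⟨t₁, h₁⟩, ⟨t₂, h₂⟩), (⟨t₃, h₃⟩, ⟨t₄, h₄⟩))), by simp [Link.quad]⟩

variable (S) in
/-- The sum of `Φ` over all pairs of flags labelled `l`. -/
def square (Φ : W → W → ℤ) (l : β × Bool) : ℤ :=
  ∑ t ∈ Finset.univ.filter (fun t => S.lab t = l),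
    ∑ t' ∈ Finset.univ.filter (fun t => S.lab t = l), Φ t t'

lemma square_along {Φ : W → W → ℤ} (l : β × Bool) :
    S.square (fun t t' => Φ (S.along t) (S.along t')) l = S.square Φ (letterInv l) := by
  unfold square
  rw [sum_filter_lab_along l fun t =>
    ∑ t' ∈ Finset.univ.filter (fun t => S.lab t = l), Φ t (S.along t')]
  exact Finset.sum_congr rfl fun t _ => sum_filter_lab_along l fun t' => Φ t t'

lemma square_eq {Φ : W → W → ℤ} (hΦ : ∀ t t', Φ t t' = Φ t' t) (hab : a.1 ≠ b.1)
    (hall : ∀ l : β × Bool, l.1 = a.1 ∨ l.1 = b.1) :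
    S.square Φ b = S.pairs Φ b (letterInv b) (letterInv b) + S.pairs Φ b a a +
      S.pairs Φ b (letterInv a) (letterInv a) + 2 * (S.pairs Φ b (letterInv b) a +
        S.pairs Φ b (letterInv b) (letterInv a) + S.pairs Φ b a (letterInv a)) := by
  have h1 := pairs_comm (S := S) hΦ b a (letterInv b)
  have h2 := pairs_comm (S := S) hΦ b (letterInv a) (letterInv b)
  have h3 := pairs_comm (S := S) hΦ b (letterInv a) a
  unfold square
  simp only [sum_filter_lab hab hall, Finset.sum_add_distrib]
  unfold pairs at *
  linear_combination h1 + h2 + h3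

/-- Write `p`, `q`, `x` and `y` for the numbers of edges from `a` to `a⁻¹`, from `b` to `b⁻¹`, from
`b` to `a` and from `b` to `a⁻¹`. Bigons and quadrangles are taken with multiplicities for which all
pairs of flags labelled `b` or `b⁻¹` are adjacent equally often. The pairs formed at `a^{±1}` by an
edge to `a^{∓1}` and an edge to `b^{±1}` are then too few, in proportion to `p - q`; the brick
patterns supply them. -/
theorem exists_balanced_links (hab : a.1 ≠ b.1) (hall : ∀ l : β × Bool, l.1 = a.1 ∨ l.1 = b.1)
    (h₁ : S.mult b a = S.mult (letterInv b) (letterInv a))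
    (h₂ : S.mult b (letterInv a) = S.mult (letterInv b) a)
    (hle₁ : S.mult b a ≤ S.mult b (letterInv b) + S.mult b (letterInv a))
    (hle₂ : S.mult b (letterInv a) ≤ S.mult b (letterInv b) + S.mult b a)
    (hle : S.mult b (letterInv b) ≤ S.mult a (letterInv a))
    (hpos : 0 < S.mult b a + S.mult b (letterInv a)) :
    ∃ 𝓒 : Multiset S.Link, (∀ Φ : W → W → ℤ, (∀ t t', Φ t t' = Φ t' t) →
      total 𝓒 Φ = total 𝓒 fun t t' => Φ (S.along t) (S.along t')) ∧ ∃ C ∈ 𝓒, 3 ≤ C.n := by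
  obtain ⟨N, 𝓑, Ψ, hN, h𝓑⟩ := exists_links_of_bricks hab hall h₁ h₂ hle₁ hle₂
  have hne : a ≠ b := fun h => hab (congrArg Prod.fst h)
  have hne' : a ≠ letterInv b := fun h => by
    have h' := congrArg Prod.fst h
    exact hab h'
  have hA : a ≠ letterInv a := (letterInv_ne a).symm
  have hB : b ≠ letterInv b := (letterInv_ne b).symm
  have hBA : letterInv b ≠ letterInv a := fun h => by
    have h' := congrArg Prod.fst h
    exact hab.symm h'
  have hbA : b ≠ letterInv a := fun h => by
    have h' := congrArg Prod.fst h
    exact hab.symm h'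
  have c₁ := S.mult_comm a b
  have c₂ := S.mult_comm (letterInv a) (letterInv b)
  have c₃ := S.mult_comm a (letterInv b)
  have c₄ := S.mult_comm (letterInv a) b
  have c₅ := S.mult_comm (letterInv a) a
  have c₆ := S.mult_comm (letterInv b) b
  -- The maxima with `1` avoid factors zero; they only concern types of edges which do not occur.
  obtain ⟨p', hp'⟩ : ∃ n, n = max (S.mult a (letterInv a)) 1 := ⟨_, rfl⟩
  obtain ⟨x', hx'⟩ : ∃ n, n = max (S.mult b a) 1 := ⟨_, rfl⟩
  obtain ⟨y', hy'⟩ : ∃ n, n = max (S.mult b (letterInv a)) 1 := ⟨_, rfl⟩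
  obtain ⟨𝓒, h𝓒⟩ : ∃ 𝓒 : Multiset S.Link, 𝓒 =
    (p' * x' * y' * N) • (S.bigons a (letterInv a) + S.bigons b (letterInv b) + S.bigons a b +
      S.bigons a (letterInv b) + S.bigons (letterInv a) b +
      S.bigons (letterInv a) (letterInv b)) +
    (2 * p' * N) • S.quads a b (letterInv a) (letterInv b) hA hB +
    (2 * y' * N) • S.quads a b (letterInv b) (letterInv a) hne' hbA +
    (2 * x' * N) • S.quads a (letterInv b) b (letterInv a) hne hBA +
    (2 * x' * y' * (S.mult a (letterInv a) - S.mult b (letterInv b))) • 𝓑 := ⟨_, rfl⟩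
  have key : ∀ Φ : W → W → ℤ, (∀ t t', Φ t t' = Φ t' t) → total 𝓒 Φ =
      p' * x' * y' * N * (S.square Φ a + S.square Φ (letterInv a) +
        (S.square Φ b + S.square Φ (letterInv b))) +
      2 * x' * y' * (S.mult a (letterInv a) - S.mult b (letterInv b)) * S.mult a (letterInv a) *
        (Ψ Φ + Ψ fun t t' => Φ (S.along t) (S.along t')) := by
    intro Φ hΦ
    have hall' : ∀ l : β × Bool, l.1 = b.1 ∨ l.1 = a.1 := fun l => (hall l).symm
    rw [square_eq hΦ hab hall, square_eq hΦ hab.symm hall',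
      square_eq (a := a) (b := letterInv b) hΦ hab hall,
      square_eq (a := b) (b := letterInv a) hΦ hab.symm hall', h𝓒]
    simp only [total_add, total_nsmul, total_bigons, total_quads, h𝓑 Φ hΦ, letterInv_letterInv]
    rw [pairs_comm hΦ a (letterInv b) b, pairs_comm hΦ (letterInv b) (letterInv a) a,
      pairs_comm hΦ a (letterInv a) b, pairs_comm hΦ (letterInv a) (letterInv b) a,
      pairs_comm hΦ a (letterInv a) (letterInv b), pairs_comm hΦ b (letterInv b) (letterInv a),
      pairs_comm hΦ (letterInv a) b a, pairs_comm hΦ b (letterInv b) a,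
      pairs_comm hΦ (letterInv b) b a, pairs_comm hΦ (letterInv b) b (letterInv a)]
    have hp : ∀ P : ℤ, (S.mult a (letterInv a) = 0 → P = 0) →
        (S.mult a (letterInv a) : ℤ) * P = p' * P := fun P hP => by
      rcases Nat.eq_zero_or_pos (S.mult a (letterInv a)) with h | h
      · rw [hP h, mul_zero, mul_zero]
      · rw [hp', max_eq_left h]
    have hx : ∀ P : ℤ, (S.mult b a = 0 → P = 0) →
        (S.mult b a : ℤ) * P = x' * P := fun P hP => by
      rcases Nat.eq_zero_or_pos (S.mult b a) with h | h
      · rw [hP h, mul_zero, mul_zero]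
      · rw [hx', max_eq_left h]
    have hy : ∀ P : ℤ, (S.mult b (letterInv a) = 0 → P = 0) →
        (S.mult b (letterInv a) : ℤ) * P = y' * P := fun P hP => by
      rcases Nat.eq_zero_or_pos (S.mult b (letterInv a)) with h | h
      · rw [hP h, mul_zero, mul_zero]
      · rw [hy', max_eq_left h]
    -- A factor `p`, `x` or `y` may be replaced by its maximum with `1` in front of a sum over pairs
    -- of edges which is empty when the factor vanishes. Each of the twelve sums of `Φ` over pairs of
    -- edges of different types is then seen to get the same coefficient on both sides.
    have e1 := hx (S.pairs Φ a b (letterInv b)) fun h => pairs_eq_zero_left (by omega)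
    have e2 := hy (S.pairs Φ a b (letterInv b)) fun h => pairs_eq_zero_right (by omega)
    have e3 := hx (S.pairs Φ b a (letterInv a)) fun h => pairs_eq_zero_left (by omega)
    have e4 := hy (S.pairs Φ b a (letterInv a)) fun h => pairs_eq_zero_right (by omega)
    have e5 := hx (S.pairs Φ (letterInv a) b (letterInv b)) fun h => pairs_eq_zero_right (by omega)
    have e6 := hy (S.pairs Φ (letterInv a) b (letterInv b)) fun h => pairs_eq_zero_left (by omega)
    have e7 := hx (S.pairs Φ (letterInv b) a (letterInv a)) fun h => pairs_eq_zero_right (by omega)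
    have e8 := hy (S.pairs Φ (letterInv b) a (letterInv a)) fun h => pairs_eq_zero_left (by omega)
    have e9 := hx (S.pairs Φ a b (letterInv a)) fun h => pairs_eq_zero_left (by omega)
    have e10 := hp (S.pairs Φ a b (letterInv a)) fun h => pairs_eq_zero_right (by omega)
    have e11 := hx (S.pairs Φ (letterInv a) a (letterInv b)) fun h => pairs_eq_zero_right (by omega)
    have e12 := hp (S.pairs Φ (letterInv a) a (letterInv b)) fun h => pairs_eq_zero_left (by omega)
    have e13 := hx (S.pairs Φ b a (letterInv b)) fun h => pairs_eq_zero_left (by omega)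
    have e14 := hp (S.pairs Φ b a (letterInv b)) fun h => pairs_eq_zero_right (by omega)
    have e15 := hx (S.pairs Φ (letterInv b) (letterInv a) b) fun h => pairs_eq_zero_left (by omega)
    have e16 := hp (S.pairs Φ (letterInv b) (letterInv a) b) fun h => pairs_eq_zero_right (by omega)
    have e17 := hy (S.pairs Φ a (letterInv b) (letterInv a)) fun h => pairs_eq_zero_left (by omega)
    have e18 := hp (S.pairs Φ a (letterInv b) (letterInv a)) fun h => pairs_eq_zero_right (by omega)
    have e19 := hy (S.pairs Φ (letterInv a) a b) fun h => pairs_eq_zero_right (by omega)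
    have e20 := hp (S.pairs Φ (letterInv a) a b) fun h => pairs_eq_zero_left (by omega)
    have e21 := hy (S.pairs Φ (letterInv b) a b) fun h => pairs_eq_zero_left (by omega)
    have e22 := hp (S.pairs Φ (letterInv b) a b) fun h => pairs_eq_zero_right (by omega)
    have e23 := hy (S.pairs Φ b (letterInv a) (letterInv b)) fun h => pairs_eq_zero_left (by omega)
    have e24 := hp (S.pairs Φ b (letterInv a) (letterInv b)) fun h => pairs_eq_zero_right (by omega)
    rw [c₁, c₂, c₃, c₅, c₆, ← h₁, ← h₂]
    push_cast [Nat.cast_sub hle]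
    generalize S.mult a (letterInv a) = p at *
    generalize S.mult b (letterInv b) = q at *
    generalize S.mult b a = x at *
    generalize S.mult b (letterInv a) = y at *
    linear_combination
      2 * (p' : ℤ) * N * ((y : ℤ) * (e1 + e3 + e5 + e7) + (x' : ℤ) * (e2 + e4 + e6 + e8)) +
      2 * (y' : ℤ) * N * ((q : ℤ) * (e9 + e11) + (x' : ℤ) * (e10 + e12)) +
      2 * (y' : ℤ) * N * ((p : ℤ) * (e13 + e15) + (x' : ℤ) * (e14 + e16)) +
      2 * (x' : ℤ) * N * ((q : ℤ) * (e17 + e19) + (y' : ℤ) * (e18 + e20)) +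
      2 * (x' : ℤ) * N * ((p : ℤ) * (e21 + e23) + (y' : ℤ) * (e22 + e24))
  refine ⟨𝓒, fun Φ hΦ => ?_, ?_⟩
  · rw [key Φ hΦ, key _ fun t t' => hΦ _ _]
    simp only [square_along, letterInv_letterInv, S.along_along]
    ring
  · have hsub : ∀ 𝓓 𝓔 : Multiset S.Link, 𝓓 ≤ 𝓔 → (∃ C ∈ 𝓓, 3 ≤ C.n) → ∃ C ∈ 𝓔, 3 ≤ C.n :=
      fun 𝓓 𝓔 h ⟨C, hC, hn⟩ => ⟨C, Multiset.mem_of_le h hC, hn⟩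
    have hmem : ∀ (n : ℕ) (𝓓 : Multiset S.Link), 0 < n → (∃ C ∈ 𝓓, 3 ≤ C.n) →
        ∃ C ∈ n • 𝓓, 3 ≤ C.n := fun n 𝓓 h0 ⟨C, hC, hn⟩ =>
      ⟨C, Multiset.mem_nsmul_of_ne_zero h0.ne' |>.2 hC, hn⟩
    have hp' : 0 < p' := by omega
    have hx' : 0 < x' := by omega
    have hy' : 0 < y' := by omega
    rw [h𝓒]
    -- If `x` or `y` is zero, then the inequalities imply that `q`, and hence `p`, is positive.
    rcases Nat.eq_zero_or_pos (S.mult b a) with hx | hx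
    · exact hsub _ _ ((Multiset.le_add_left _ _).trans (Multiset.le_add_right _ _))
        (hmem _ _ (by positivity)
          (exists_mem_quads _ _ (by omega) (by omega) (by omega) (by omega)))
    rcases Nat.eq_zero_or_pos (S.mult b (letterInv a)) with hy | hy
    · exact hsub _ _ ((Multiset.le_add_left _ _).trans (Multiset.le_add_right _ _ |>.trans
        (Multiset.le_add_right _ _)))
        (hmem _ _ (by positivity)
          (exists_mem_quads _ _ (by omega) (by omega) (by omega) (by omega)))
    · exact hsub _ _ ((Multiset.le_add_left _ _).trans (Multiset.le_add_right _ _ |>.trans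
        (Multiset.le_add_right _ _ |>.trans (Multiset.le_add_right _ _))))
        (hmem _ _ (by positivity)
          (exists_mem_quads _ _ (by omega) (by omega) (by omega) (by omega)))

end Balance
end FlagSystem
/-! ### Consequences of minimality for the Whitehead graph -/

namespace FlagSystem

section Counts

variable {W β : Type} [Fintype W] [DecidableEq β] {S : FlagSystem W β} {a b : β × Bool}

lemma mult_eq_mult_letterInv (hab : a.1 ≠ b.1) (hall : ∀ l : β × Bool, l.1 = a.1 ∨ l.1 = b.1) :
    S.mult b a = S.mult (letterInv b) (letterInv a) ∧
      S.mult b (letterInv a) = S.mult (letterInv b) a := by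
  have hall' : ∀ l : β × Bool, l.1 = b.1 ∨ l.1 = a.1 := fun l => (hall l).symm
  have h1 := card_filter_lab_letterInv (S := S) a
  have h2 := card_filter_lab_letterInv (S := S) b
  rw [card_filter_lab hab hall, card_filter_lab (b := letterInv b) hab hall,
    letterInv_letterInv, S.mult_comm (letterInv b) b] at h2
  rw [card_filter_lab hab.symm hall', card_filter_lab (b := letterInv a) hab.symm hall',
    letterInv_letterInv, S.mult_comm (letterInv a) a, S.mult_comm a b,
    S.mult_comm a (letterInv b), S.mult_comm (letterInv a) b,
    S.mult_comm (letterInv a) (letterInv b)] at h1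
  omega

lemma mult_le_of_card_le_cut (hab : a.1 ≠ b.1) (hall : ∀ l : β × Bool, l.1 = a.1 ∨ l.1 = b.1)
    (hcut : (Finset.univ.filter fun t => S.lab t = a).card ≤
      (Finset.univ.filter fun t => (S.lab t = a ∨ S.lab t = b) ∧
        ¬ (S.lab (S.across t) = a ∨ S.lab (S.across t) = b)).card) :
    S.mult a b ≤ S.mult b (letterInv b) + S.mult b (letterInv a) := by
  classical
  have h1 : (Finset.univ.filter fun t => (S.lab t = a ∨ S.lab t = b) ∧
      ¬ (S.lab (S.across t) = a ∨ S.lab (S.across t) = b)) ⊆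
      (S.edges a (letterInv a) ∪ S.edges a (letterInv b)) ∪
        (S.edges b (letterInv a) ∪ S.edges b (letterInv b)) := by
    intro t ht
    simp only [Finset.mem_filter, Finset.mem_univ, true_and, Finset.mem_union, mem_edges]
      at ht ⊢
    have h : S.lab (S.across t) = letterInv a ∨ S.lab (S.across t) = letterInv b := by
      rcases hall (S.lab (S.across t)) with h | h <;>
        rcases eq_or_eq_letterInv h with h | h <;> tauto
    tauto
  have h2 := Finset.card_le_card h1
  have h3 := Finset.card_union_le (S.edges a (letterInv a) ∪ S.edges a (letterInv b))
    (S.edges b (letterInv a) ∪ S.edges b (letterInv b))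
  have h4 := Finset.card_union_le (S.edges a (letterInv a)) (S.edges a (letterInv b))
  have h5 := Finset.card_union_le (S.edges b (letterInv a)) (S.edges b (letterInv b))
  rw [card_filter_lab hab.symm fun l => (hall l).symm] at hcut
  simp only [mult] at *
  omega

lemma mult_pos_of_fst_ne (hab : a.1 ≠ b.1) (hall : ∀ l : β × Bool, l.1 = a.1 ∨ l.1 = b.1)
    (h : ∃ t, (S.lab t).1 ≠ (S.lab (S.across t)).1) :
    0 < S.mult b a + S.mult b (letterInv a) := by
  have key : ∃ t, (S.lab t).1 = b.1 ∧ (S.lab (S.across t)).1 = a.1 := by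
    obtain ⟨t, ht⟩ := h
    rcases hall (S.lab t) with h | h <;> rcases hall (S.lab (S.across t)) with h' | h'
    · exact absurd (h.trans h'.symm) ht
    · exact ⟨S.across t, h', by rw [S.across_across, h]⟩
    · exact ⟨t, h, h'⟩
    · exact absurd (h.trans h'.symm) ht
  obtain ⟨t, h, h'⟩ := key
  have hpos : 0 < S.mult (S.lab t) (S.lab (S.across t)) :=
    Finset.card_pos.2 ⟨t, mem_edges.2 ⟨rfl, rfl⟩⟩
  obtain ⟨h1, h2⟩ := mult_eq_mult_letterInv (S := S) hab hall
  rcases eq_or_eq_letterInv h with h | h <;> rcases eq_or_eq_letterInv h' with h' | h' <;>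
    rw [h, h'] at hpos <;> omega

end Counts

/-- If no Whitehead automorphism shortens the given words, and the Whitehead graph has an edge
between letters which are not inverse to each other, then there is a balanced family of links. -/
theorem exists_balanced_links_of_card_le_cut {W β : Type} [Fintype W] [DecidableEq β]
    {S : FlagSystem W β} {a b : β × Bool} (hab : a.1 ≠ b.1)
    (hall : ∀ l : β × Bool, l.1 = a.1 ∨ l.1 = b.1)
    (hcut : ∀ l m : β × Bool, l.1 ≠ m.1 → (Finset.univ.filter fun t => S.lab t = l).card ≤
      (Finset.univ.filter fun t => (S.lab t = l ∨ S.lab t = m) ∧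
        ¬ (S.lab (S.across t) = l ∨ S.lab (S.across t) = m)).card)
    (h : ∃ t, (S.lab t).1 ≠ (S.lab (S.across t)).1) :
    ∃ 𝓒 : Multiset S.Link, (∀ Φ : W → W → ℤ, (∀ t t', Φ t t' = Φ t' t) →
      total 𝓒 Φ = total 𝓒 fun t t' => Φ (S.along t) (S.along t')) ∧ ∃ C ∈ 𝓒, 3 ≤ C.n := by
  have key : ∀ a b : β × Bool, a.1 ≠ b.1 → (∀ l : β × Bool, l.1 = a.1 ∨ l.1 = b.1) →
      S.mult b (letterInv b) ≤ S.mult a (letterInv a) →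
      ∃ 𝓒 : Multiset S.Link, (∀ Φ : W → W → ℤ, (∀ t t', Φ t t' = Φ t' t) →
        total 𝓒 Φ = total 𝓒 fun t t' => Φ (S.along t) (S.along t')) ∧ ∃ C ∈ 𝓒, 3 ≤ C.n := by
    intro a b hab hall hle
    obtain ⟨h₁, h₂⟩ := mult_eq_mult_letterInv (S := S) hab hall
    have hle₁ := mult_le_of_card_le_cut hab hall (hcut a b hab)
    have hle₂ := mult_le_of_card_le_cut (a := letterInv a) hab hall (hcut (letterInv a) b hab)
    rw [S.mult_comm] at hle₁ hle₂
    rw [letterInv_letterInv] at hle₂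
    exact exists_balanced_links hab hall h₁ h₂ hle₁ hle₂ hle (mult_pos_of_fst_ne hab hall h)
  rcases le_total (S.mult b (letterInv b)) (S.mult a (letterInv a)) with hle | hle
  · exact key a b hab hall hle
  · exact key b a hab.symm (fun l => (hall l).symm) hle

end FlagSystem

end TilingRankTwo

theorem mainTheorem5 (U : List (FreeGroup (Fin 2)))
    (hred : ∀ u ∈ U, FreeGroup.IsCyclicallyReduced u.toWord)
    (hmin : TilingRankTwo.IsMinimal U)
    (hdisk : TilingRankTwo.IsDiskbusting U) :
    TilingRankTwo.IsPolygonal U := by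
  have hall : ∀ l : Fin 2 × Bool, l.1 = ((0, true) : Fin 2 × Bool).1 ∨
      l.1 = ((1, true) : Fin 2 × Bool).1 := fun l => by
    change l.1 = 0 ∨ l.1 = 1
    omega
  obtain ⟨𝓒, h𝓒, h3⟩ := TilingRankTwo.FlagSystem.exists_balanced_links_of_card_le_cut
    (S := TilingRankTwo.wordSystem U hred) (by decide) hall
    (fun _ _ h => TilingRankTwo.card_le_card_cut_of_isMinimal U hred hmin h)
    (TilingRankTwo.exists_fst_ne_of_isDiskbusting U hred hdisk)
  obtain ⟨P, f, hf, hχ⟩ := TilingRankTwo.FlagSystem.exists_immersion_of_total_eq 𝓒 h𝓒 h3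
  refine ⟨P, f, fun i => ?_, hχ⟩
  obtain ⟨t, ht, hw⟩ := hf i
  rw [hw]
  exact TilingRankTwo.wordSystem_ofFn_isRotated U hred t _ (P.sides_pos i) ht
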